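/- Let $\Sigma$ be a compact Riemann surface with a (smooth) Hermitian metric $g_\Sigma$, and let $L\to\Sigma$ be a smooth Hermitian line bundle with a smooth connection $\nabla$. Put $\mathbb S^+=L$ and $\mathbb S^-=\Lambda^{0,1}_{\mathbb C}(\Sigma)\otimes L$. Let $\bar\partial:\Gamma(\mathbb S^+)\to\Gamma(\mathbb S^-)$, $\bar\partial u=(\nabla u)^{0,1}$, be the Dolbeault operator, $\bar\partial^*$ its formal adjoint, and $\partial^-=i\bar\partial$, $\partial^+=-i\bar\partial^*$. The fibre metric of $\Lambda^{0,1}_{\mathbb C}(\Sigma)$ is normalised by $|d\bar z|^2=c$ at a point where $z=x_2+ix_3$ is a holomorphic coordinate with $\partial/\partial x_2,\partial/\partial x_3$ orthonormal, for a constant $0<c\le 4$ (the usual normalisations are $c=1,2,4$). Let $$\lambda_{\partial^-}=\inf_{0\ne u\in L^{1,2}(\Sigma,\mathbb S^+)}\frac{\|\partial^-u\|^2_{L^2}}{\|u\|^2_{L^2}},\qquad \lambda_{\partial^+}=\inf_{0\ne v\in L^{1,2}(\Sigma,\mathbb S^-)}\frac{\|\partial^+v\|^2_{L^2}}{\|v\|^2_{L^2}}$$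 be the first eigenvalues of $\partial^+\partial^-$ on $\mathbb S^+$ and of $\partial^-\partial^+$ on $\mathbb S^-$. Let $h:\Sigma\to(0,\infty)$ be smooth, let $K>0$ be a constant with $\frac1K\le h\le K$ on $\Sigma$, and let $\varepsilon>0$. On $A_\varepsilon=[0,\varepsilon]\times\Sigma$ take the warped metric $h\,dx_1^2+g_\Sigma$, with volume form $h^{1/2}\,dvol_\Sigma\,dx_1$, and pull $\mathbb S^\pm$ back to $A_\varepsilon$, $\mathbb S=\mathbb S^+\oplus\mathbb S^-$. For sections $V=(u,v)$ of $\mathbb S$ let $$\mathcal D V=\Bigl(i h^{-1/2}\frac{\partial u}{\partial x_1}+\bar\partial^* v,\; -i h^{-1/2}\frac{\partial v}{\partial x_1}+\bar\partial u\Bigr).$$ Let $L^{1,2}_-(A_\varepsilon,\mathbb S)$ (respectively $L^{1,2}_+(A_\varepsilon,\mathbb S)$) be the closure, in the $L^{1,2}$-norm, of the smooth sections $V=(u,v)$ on $A_\varepsilon$ for which $v$ (respectively $u$) has compact support in $(0,\varepsilon)\times\Sigma$, and let $$\lambda_{\mathcal D_\pm}=\inf_{0\ne V\in L^{1,2}_\pm(A_\varepsilon,\mathbb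 S)}\frac{\|\mathcal D V\|^2_{L^2(A_\varepsilon,\mathbb S)}}{\|V\|^2_{L^2(A_\varepsilon,\mathbb S)}}.$$ Then, for both signs, $$\lambda_{\mathcal D_\pm}\ \ge\ \frac1K\,\min\Bigl\{\lambda_{\partial^\pm},\ \frac{2}{K\varepsilon^2}-K\,\bigl\|h^{-1/2}\bigr\|^2_{C^1(\Sigma)}\Bigr\},$$ where $\|f\|_{C^1(\Sigma)}=\sup_\Sigma|f|+\sup_\Sigma|\nabla f|$. -/

import Mathlib

open Set Filter MeasureTheory Bundle
open scoped Manifold ContDiff Topology ENNReal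

/-- A Riemann surface (a one-dimensional complex analytic manifold) is a smooth real surface. -/
instance realSmoothOfComplexAnalytic {X : Type*} [TopologicalSpace X] [ChartedSpace ℂ X]
    [IsManifold 𝓘(ℂ) ω X] : IsManifold 𝓘(ℝ, ℂ) ∞ X := by
  apply isManifold_of_contDiffOn
  intro e e' he he'
  have h1 := (contDiffGroupoid ω 𝓘(ℂ)).compatible he he'
  have h := (contDiffGroupoid_le (m := ∞) le_top h1)
  have h3 := (mem_groupoid_of_pregroupoid.1 h).1
  simp only [contDiffPregroupoid] at h3
  exact ContDiffOn.restrict_scalars ℝ h3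

namespace ThinDirac

noncomputable section

/-! ### The compact Riemann surface and its metric -/

section Surface

variable {X : Type*} [TopologicalSpace X] [ChartedSpace ℂ X]

/-- The real tangent plane of the surface at `x`. As a vector space it is `ℂ`, the identification
being given by the preferred holomorphic chart at `x`. -/
abbrev Tan (x : X) : Type := TangentSpace 𝓘(ℝ, ℂ) x

/-- The coordinate vector `∂/∂x₂` (of the preferred holomorphic chart at `x`) at the point `x`. -/
def e₂ (x : X) : Tan x := (1 : ℂ)

/-- The coordinate vector `∂/∂x₃` (of the preferred holomorphic chart at `x`) at the point `x`. -/
def e₃ (x : X) : Tan x := (Complex.I : ℂ)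

/-- The complex structure of the tangent plane: multiplication by `i` in a holomorphic chart. -/
def rotJ (x : X) : Tan x →L[ℝ] Tan x :=
  (Complex.I • ContinuousLinearMap.id ℝ ℂ : ℂ →L[ℝ] ℂ)

variable [IsManifold 𝓘(ℂ) ω X]

/-- Smooth Riemannian metrics on the surface. -/
abbrev Metric (X : Type*) [TopologicalSpace X] [ChartedSpace ℂ X] [IsManifold 𝓘(ℂ) ω X] :=
  ContMDiffRiemannianMetric 𝓘(ℝ, ℂ) ∞ ℂ (fun x : X ↦ Tan x)

/-- The metric is compatible with the complex structure (Hermitian, hence Kähler). -/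
def IsHermitianMetric (g : Metric X) : Prop :=
  ∀ (x : X) (a b : Tan x), g.inner x (rotJ x a) (rotJ x b) = g.inner x a b

/-- The conformal factor at `x`: squared length of the coordinate vector `e₂ x`. For a Hermitian
metric `e₂ x, e₃ x` are orthogonal and both have this squared length. -/
def conf (g : Metric X) (x : X) : ℝ := g.inner x (e₂ x) (e₂ x)

/-- The coordinate vector field with constant coefficient `a` of the preferred chart at `x`
(meaningful on the domain of this chart). -/
def coordField (x : X) (a : ℂ) (y : X) : Tan y := tangentCoordChange 𝓘(ℝ, ℂ) x y y a

/-- The coefficient `g(∂_a, ∂_b)` of the metric in the preferred chart at `x`. -/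
def metricCoeff (g : Metric X) (x : X) (a b : ℂ) (y : X) : ℝ :=
  g.inner y (coordField x a y) (coordField x b y)

/-- The area density `√(det g)` in the preferred chart at `x`. -/
def areaDensity (g : Metric X) (x y : X) : ℝ :=
  Real.sqrt (metricCoeff g x 1 1 y * metricCoeff g x Complex.I Complex.I y
    - metricCoeff g x 1 Complex.I y ^ 2)

/-- The Riemannian area measure on the domain of the preferred chart at `x` (zero outside). -/
def chartArea (g : Metric X) [MeasurableSpace X] (x : X) : Measure X :=
  ((volume.restrict (chartAt ℂ x).target).withDensity
    (fun z ↦ ENNReal.ofReal (areaDensity g x ((chartAt ℂ x).symm z)))).map (chartAt ℂ x).symm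

/-- The Riemannian area measure of the surface: the least measure which dominates all the
`chartArea g x`, that is, the measure which restricts to `chartArea g x` on each chart domain. -/
def area (g : Metric X) [MeasurableSpace X] : Measure X := ⨆ x : X, chartArea g x

/-- `g(D_a ∂_b, ∂_c)` at `x` for the Levi-Civita connection `D`, by the Koszul formula for the
(commuting) coordinate vector fields `∂_a, ∂_b, ∂_c` of the preferred chart at `x`. -/
def koszul (g : Metric X) (x : X) (a b c : ℂ) : ℝ :=
  (mvfderiv 𝓘(ℝ, ℂ) (metricCoeff g x b c) x (a : ℂ)
    + mvfderiv 𝓘(ℝ, ℂ) (metricCoeff g x c a) x (b : ℂ)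
    - mvfderiv 𝓘(ℝ, ℂ) (metricCoeff g x a b) x (c : ℂ)) / 2

/-- `D_a ∂_b` at `x` for the Levi-Civita connection `D` of a Hermitian metric. -/
def leviCivita (g : Metric X) (x : X) (a b : ℂ) : Tan x :=
  (koszul g x a b 1 / conf g x) • e₂ x + (koszul g x a b Complex.I / conf g x) • e₃ x

/-- Length of the gradient of a real function. -/
def gradNorm (g : Metric X) (f : X → ℝ) (x : X) : ℝ :=
  Real.sqrt ((mvfderiv 𝓘(ℝ, ℂ) f x (e₂ x) ^ 2 + mvfderiv 𝓘(ℝ, ℂ) f x (e₃ x) ^ 2) / conf g x)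

/-- The `C¹`-norm `sup |f| + sup |∇f|` of a real function on the surface. -/
def normC1 (g : Metric X) (f : X → ℝ) : ℝ := (⨆ x, |f x|) + ⨆ x, gradNorm g f x

end Surface

/-! ### The Hermitian line bundle `L = 𝕊⁺` and the bundle `𝕊⁻ = Λ^{0,1} ⊗ L`

The fibre of `Λ^{0,1} ⊗ L` at `x` consists of the antilinear maps `T_x → L_x`. -/

section Bundles

variable {X : Type*} [TopologicalSpace X] [ChartedSpace ℂ X] [IsManifold 𝓘(ℂ) ω X]
  {L : X → Type*} [TopologicalSpace (TotalSpace ℂ L)]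
  [∀ x, NormedAddCommGroup (L x)] [∀ x, InnerProductSpace ℂ (L x)]
  [FiberBundle ℂ L] [VectorBundle ℝ ℂ L]

variable (L) in
/-- The Hermitian metric of `L` is smooth: its real part is a smooth section of bilinear forms. -/
def IsSmoothHermitian : Prop :=
  ∃ G : ∀ x, L x →L[ℝ] L x →L[ℝ] ℝ,
    ContMDiff 𝓘(ℝ, ℂ) (𝓘(ℝ, ℂ).prod 𝓘(ℝ, ℂ →L[ℝ] ℂ →L[ℝ] ℝ)) ∞
      (fun x ↦ (⟨x, G x⟩ :
        TotalSpace (ℂ →L[ℝ] ℂ →L[ℝ] ℝ) (fun x : X ↦ L x →L[ℝ] L x →L[ℝ] ℝ))) ∧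
    ∀ (x : X) (a b : L x), G x a b = (inner ℂ a b).re

/-- `v` is a section of `Λ^{0,1} ⊗ L`. -/
def IsForm01 (v : ∀ x, Tan x →L[ℝ] L x) : Prop :=
  ∀ (x : X) (a : Tan x), v x (rotJ x a) = -(Complex.I • v x a)

/-- `u` is a smooth section of `L`. -/
def SmoothSection (u : ∀ x, L x) : Prop :=
  ContMDiff 𝓘(ℝ, ℂ) (𝓘(ℝ, ℂ).prod 𝓘(ℝ, ℂ)) ∞ (fun x ↦ (⟨x, u x⟩ : TotalSpace ℂ L))

/-- `v` is a smooth section of `Λ^{0,1} ⊗ L`. -/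
def SmoothForm01 (v : ∀ x, Tan x →L[ℝ] L x) : Prop :=
  IsForm01 v ∧ ContMDiff 𝓘(ℝ, ℂ) (𝓘(ℝ, ℂ).prod 𝓘(ℝ, ℂ →L[ℝ] ℂ)) ∞
    (fun x ↦ (⟨x, v x⟩ : TotalSpace (ℂ →L[ℝ] ℂ) (fun x : X ↦ Tan x →L[ℝ] L x)))

/-- The Hermitian product of two elements of the fibre of `Λ^{0,1} ⊗ L` at `x`, where the metric
of `Λ^{0,1}` is normalised by `|dz̄|² = c` at a point where `∂/∂x₂, ∂/∂x₃` are orthonormal. -/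
def inner01 (c : ℝ) (g : Metric X) (x : X) (a b : Tan x →L[ℝ] L x) : ℂ :=
  ((c / conf g x : ℝ) : ℂ) * inner ℂ (a (e₂ x)) (b (e₂ x))

/-- The squared length in the fibre of `Λ^{0,1} ⊗ L` at `x` (same normalisation). -/
def normSq01 (c : ℝ) (g : Metric X) (x : X) (a : Tan x →L[ℝ] L x) : ℝ :=
  c / conf g x * ‖a (e₂ x)‖ ^ 2

/-- The connection `nabla` is complex linear. -/
def IsComplexLinear (nabla : CovariantDerivative 𝓘(ℝ, ℂ) ℂ L) : Prop :=
  ∀ (u : ∀ x, L x) (x : X),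
    MDifferentiableAt 𝓘(ℝ, ℂ) (𝓘(ℝ, ℂ).prod 𝓘(ℝ, ℂ)) (fun y ↦ (⟨y, u y⟩ : TotalSpace ℂ L)) x →
    ∀ a : Tan x, nabla (fun y ↦ Complex.I • u y) x a = Complex.I • nabla u x a

/-- The Dolbeault operator `∂̄ u = (∇u)^{0,1}`, i.e. `(∂̄ u)(a) = (∇_a u + i ∇_{ia} u) / 2`. -/
def dbar (nabla : CovariantDerivative 𝓘(ℝ, ℂ) ℂ L) (u : ∀ x, L x) (x : X) :
    Tan x →L[ℝ] L x :=
  (2⁻¹ : ℝ) • (nabla u x + Complex.I • (nabla u x).comp (rotJ x))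

/-- `w = ∂̄* v`, where `∂̄*` is the formal adjoint of `∂̄`: the section `w` satisfies
`⟨∂̄ s, v⟩ = ⟨s, w⟩` in `L²` for every smooth section `s` of `L`. -/
def IsDbarStar [MeasurableSpace X] (c : ℝ) (g : Metric X)
    (nabla : CovariantDerivative 𝓘(ℝ, ℂ) ℂ L)
    (v : ∀ x, Tan x →L[ℝ] L x) (w : ∀ x, L x) : Prop :=
  SmoothSection w ∧ ∀ s : ∀ x, L x, SmoothSection s →
    ∫ x, inner01 c g x (dbar nabla s x) (v x) ∂(area g) = ∫ x, inner ℂ (s x) (w x) ∂(area g)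

/-- `|∇_Σ u|²` for a section `u` of `L`. -/
def gradSq (g : Metric X) (nabla : CovariantDerivative 𝓘(ℝ, ℂ) ℂ L) (u : ∀ x, L x) (x : X) : ℝ :=
  (‖nabla u x (e₂ x)‖ ^ 2 + ‖nabla u x (e₃ x)‖ ^ 2) / conf g x

/-- `(∇_a v)(e₂)` at `x` for the connection of `Λ^{0,1} ⊗ L` induced by `nabla` and the
Levi-Civita connection `D`: `(∇_a v)(∂₂) = ∇_a (v(∂₂)) - v(D_a ∂₂)`. -/
def covDeriv01 (g : Metric X) (nabla : CovariantDerivative 𝓘(ℝ, ℂ) ℂ L)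
    (v : ∀ x, Tan x →L[ℝ] L x) (x : X) (a : ℂ) : L x :=
  nabla (fun y ↦ v y (coordField x 1 y)) x (a : ℂ) - v x (leviCivita g x a 1)

/-- `|∇_Σ v|²` for a section `v` of `Λ^{0,1} ⊗ L`. -/
def gradSq01 (c : ℝ) (g : Metric X) (nabla : CovariantDerivative 𝓘(ℝ, ℂ) ℂ L)
    (v : ∀ x, Tan x →L[ℝ] L x) (x : X) : ℝ :=
  c / conf g x *
    ((‖covDeriv01 g nabla v x 1‖ ^ 2 + ‖covDeriv01 g nabla v x Complex.I‖ ^ 2) / conf g x)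

/-! ### The operators `∂^-`, `∂^+` on the surface and their lowest Rayleigh quotients -/

variable [MeasurableSpace X]

/-- `‖u‖²` in `L²(Σ, 𝕊⁺)`. -/
def l2Sq (g : Metric X) (u : ∀ x, L x) : ℝ≥0∞ :=
  ∫⁻ x, ENNReal.ofReal (‖u x‖ ^ 2) ∂(area g)

/-- `‖v‖²` in `L²(Σ, 𝕊⁻)`. -/
def l2Sq01 (c : ℝ) (g : Metric X) (v : ∀ x, Tan x →L[ℝ] L x) : ℝ≥0∞ :=
  ∫⁻ x, ENNReal.ofReal (normSq01 c g x (v x)) ∂(area g)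

/-- `‖u‖²` in `L^{1,2}(Σ, 𝕊⁺)`. -/
def sobSq (g : Metric X) (nabla : CovariantDerivative 𝓘(ℝ, ℂ) ℂ L) (u : ∀ x, L x) : ℝ≥0∞ :=
  ∫⁻ x, ENNReal.ofReal (‖u x‖ ^ 2 + gradSq g nabla u x) ∂(area g)

/-- `‖v‖²` in `L^{1,2}(Σ, 𝕊⁻)`. -/
def sobSq01 (c : ℝ) (g : Metric X) (nabla : CovariantDerivative 𝓘(ℝ, ℂ) ℂ L)
    (v : ∀ x, Tan x →L[ℝ] L x) : ℝ≥0∞ :=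
  ∫⁻ x, ENNReal.ofReal (normSq01 c g x (v x) + gradSq01 c g nabla v x) ∂(area g)

/-- `u` is a measurable section of `L`. -/
def MeasSection (g : Metric X) (u : ∀ x, L x) : Prop :=
  AEStronglyMeasurable (fun x ↦ (⟨x, u x⟩ : TotalSpace ℂ L)) (area g)

/-- `v` is a measurable section of `Λ^{0,1} ⊗ L`. -/
def MeasForm01 (g : Metric X) (v : ∀ x, Tan x →L[ℝ] L x) : Prop :=
  IsForm01 v ∧ AEStronglyMeasurable
    (fun x ↦ (⟨x, v x⟩ : TotalSpace (ℂ →L[ℝ] ℂ) (fun x : X ↦ Tan x →L[ℝ] L x))) (area g)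

/-- `u` is in `L^{1,2}(Σ, 𝕊⁺)`, the closure of the smooth sections in the `L^{1,2}`-norm, and
`w = ∂^- u` in `L²`, where `∂^- = i ∂̄` is extended by continuity. -/
def DelMinus (c : ℝ) (g : Metric X) (nabla : CovariantDerivative 𝓘(ℝ, ℂ) ℂ L)
    (u : ∀ x, L x) (w : ∀ x, Tan x →L[ℝ] L x) : Prop :=
  MeasSection g u ∧ MeasForm01 g w ∧ ∃ s : ℕ → ∀ x, L x,
    (∀ n, SmoothSection (s n)) ∧
    (∀ η : ℝ≥0∞, 0 < η → ∃ N, ∀ m ≥ N, ∀ n ≥ N, sobSq g nabla (fun x ↦ s m x - s n x) < η) ∧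
    Tendsto (fun n ↦ l2Sq g (fun x ↦ s n x - u x)) atTop (𝓝 0) ∧
    Tendsto (fun n ↦ l2Sq01 c g (fun x ↦ Complex.I • dbar nabla (s n) x - w x)) atTop (𝓝 0)

/-- `v` is in `L^{1,2}(Σ, 𝕊⁻)`, the closure of the smooth sections in the `L^{1,2}`-norm, and
`w = ∂^+ v` in `L²`, where `∂^+ = -i ∂̄*` is extended by continuity. -/
def DelPlus (c : ℝ) (g : Metric X) (nabla : CovariantDerivative 𝓘(ℝ, ℂ) ℂ L)
    (v : ∀ x, Tan x →L[ℝ] L x) (w : ∀ x, L x) : Prop :=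
  MeasForm01 g v ∧ MeasSection g w ∧ ∃ (s : ℕ → ∀ x, Tan x →L[ℝ] L x) (r : ℕ → ∀ x, L x),
    (∀ n, SmoothForm01 (s n) ∧ IsDbarStar c g nabla (s n) (r n)) ∧
    (∀ η : ℝ≥0∞, 0 < η → ∃ N, ∀ m ≥ N, ∀ n ≥ N,
      sobSq01 c g nabla (fun x ↦ s m x - s n x) < η) ∧
    Tendsto (fun n ↦ l2Sq01 c g (fun x ↦ s n x - v x)) atTop (𝓝 0) ∧
    Tendsto (fun n ↦ l2Sq g (fun x ↦ -(Complex.I • r n x) - w x)) atTop (𝓝 0)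

/-- `λ_{∂^-}`, the first eigenvalue of `∂^+ ∂^-` on `L^{1,2}(Σ, 𝕊⁺)`: the infimum of
`‖∂^- u‖² / ‖u‖²` over `0 ≠ u ∈ L^{1,2}(Σ, 𝕊⁺)`. -/
def lamDelMinus (c : ℝ) (g : Metric X) (nabla : CovariantDerivative 𝓘(ℝ, ℂ) ℂ L) : ℝ≥0∞ :=
  ⨅ (u : ∀ x, L x) (w : ∀ x, Tan x →L[ℝ] L x) (_ : DelMinus c g nabla u w) (_ : l2Sq g u ≠ 0),
    l2Sq01 c g w / l2Sq g u

/-- `λ_{∂^+}`, the first eigenvalue of `∂^- ∂^+` on `L^{1,2}(Σ, 𝕊⁻)`: the infimum of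
`‖∂^+ v‖² / ‖v‖²` over `0 ≠ v ∈ L^{1,2}(Σ, 𝕊⁻)`. -/
def lamDelPlus (c : ℝ) (g : Metric X) (nabla : CovariantDerivative 𝓘(ℝ, ℂ) ℂ L) : ℝ≥0∞ :=
  ⨅ (v : ∀ x, Tan x →L[ℝ] L x) (w : ∀ x, L x) (_ : DelPlus c g nabla v w) (_ : l2Sq01 c g v ≠ 0),
    l2Sq g w / l2Sq01 c g v

end Bundles

/-! ### Spinors on `A_ε = [0, ε] × Σ` and the operator `𝒟` -/

section ThinManifold

variable {X : Type*} [TopologicalSpace X] [ChartedSpace ℂ X] [IsManifold 𝓘(ℂ) ω X]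

/-- A (not necessarily continuous) section `V = (u, v)` of `𝕊 = 𝕊⁺ ⊕ 𝕊⁻` over `[0, ε] × Σ`; only
the values at times `t ∈ [0, ε]` matter. -/
structure Spinor (L : X → Type*)
    [∀ x, NormedAddCommGroup (L x)] [∀ x, InnerProductSpace ℂ (L x)] where
  /-- the component in `𝕊⁺ = L` -/
  u : ℝ → ∀ x, L x
  /-- the component in `𝕊⁻ = Λ^{0,1} ⊗ L` -/
  v : ℝ → ∀ x, Tan x →L[ℝ] L x

variable {L : X → Type*} [TopologicalSpace (TotalSpace ℂ L)]
  [∀ x, NormedAddCommGroup (L x)] [∀ x, InnerProductSpace ℂ (L x)]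
  [FiberBundle ℂ L] [VectorBundle ℝ ℂ L]

/-- The pointwise difference of two sections. -/
def Spinor.diff (V W : Spinor L) : Spinor L where
  u t x := V.u t x - W.u t x
  v t x := V.v t x - W.v t x

/-- `V` is smooth on `[0, ε] × Σ`, up to the boundary. -/
def Spinor.IsSmooth (ε : ℝ) (V : Spinor L) : Prop :=
  ContMDiffOn (𝓘(ℝ, ℝ).prod 𝓘(ℝ, ℂ)) (𝓘(ℝ, ℂ).prod 𝓘(ℝ, ℂ)) ∞
    (fun p : ℝ × X ↦ (⟨p.2, V.u p.1 p.2⟩ : TotalSpace ℂ L)) (Icc 0 ε ×ˢ univ) ∧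
  ContMDiffOn (𝓘(ℝ, ℝ).prod 𝓘(ℝ, ℂ)) (𝓘(ℝ, ℂ).prod 𝓘(ℝ, ℂ →L[ℝ] ℂ)) ∞
    (fun p : ℝ × X ↦
      (⟨p.2, V.v p.1 p.2⟩ : TotalSpace (ℂ →L[ℝ] ℂ) (fun x : X ↦ Tan x →L[ℝ] L x)))
    (Icc 0 ε ×ˢ univ) ∧
  ∀ t ∈ Icc 0 ε, IsForm01 (V.v t)

/-- Smooth sections whose `𝕊⁻`-component has compact support in the interior `(0, ε) × Σ`
(recall that `Σ` is compact). -/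
def TestMinus (ε : ℝ) (V : Spinor L) : Prop :=
  V.IsSmooth ε ∧ ∃ a b, 0 < a ∧ b < ε ∧ ∀ t ∈ Icc 0 ε, t ∉ Icc a b → ∀ x, V.v t x = 0

/-- Smooth sections whose `𝕊⁺`-component has compact support in the interior `(0, ε) × Σ`. -/
def TestPlus (ε : ℝ) (V : Spinor L) : Prop :=
  V.IsSmooth ε ∧ ∃ a b, 0 < a ∧ b < ε ∧ ∀ t ∈ Icc 0 ε, t ∉ Icc a b → ∀ x, V.u t x = 0

/-- `∂u/∂x₁` on `[0, ε] × Σ`. -/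
def dtU (ε : ℝ) (V : Spinor L) (t : ℝ) (x : X) : L x :=
  derivWithin (fun s ↦ V.u s x) (Icc 0 ε) t

/-- `∂v/∂x₁` on `[0, ε] × Σ`, evaluated at the tangent vector `a` of `Σ`. -/
def dtV (ε : ℝ) (V : Spinor L) (t : ℝ) (x : X) (a : Tan x) : L x :=
  derivWithin (fun s ↦ V.v s x a) (Icc 0 ε) t

variable [MeasurableSpace X]

/-- `W = 𝒟 V` for smooth `V = (u, v)`, where `𝒟 = e₁ · h^{-1/2} ∂/∂x₁ + (∂̄, ∂̄*)` and
`e₁ · (u, v) = (i u, - i v)`, that is,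
`𝒟 (u, v) = (i h^{-1/2} ∂u/∂x₁ + ∂̄* v, - i h^{-1/2} ∂v/∂x₁ + ∂̄ u)`. -/
def IsDirac (c : ℝ) (g : Metric X) (nabla : CovariantDerivative 𝓘(ℝ, ℂ) ℂ L) (h : X → ℝ) (ε : ℝ)
    (V W : Spinor L) : Prop :=
  W.IsSmooth ε ∧ ∀ t ∈ Icc 0 ε,
    IsDbarStar c g nabla (V.v t)
      (fun x ↦ W.u t x - Complex.I • (Real.sqrt (h x))⁻¹ • dtU ε V t x) ∧
    ∀ (x : X) (a : Tan x),
      W.v t x a = -(Complex.I • (Real.sqrt (h x))⁻¹ • dtV ε V t x a) + dbar nabla (V.u t) x a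

/-- `‖V‖²` in `L²(A_ε, 𝕊)`, with the volume form `h^{1/2} dvol_Σ dx₁` of the warped metric. -/
def Spinor.l2Sq (c : ℝ) (g : Metric X) (h : X → ℝ) (ε : ℝ) (V : Spinor L) : ℝ≥0∞ :=
  ∫⁻ t in Icc 0 ε, ∫⁻ x,
    ENNReal.ofReal ((‖V.u t x‖ ^ 2 + normSq01 c g x (V.v t x)) * Real.sqrt (h x)) ∂(area g)

/-- `‖V‖²` in `L^{1,2}(A_ε, 𝕊)`. -/
def Spinor.sobSq (c : ℝ) (g : Metric X) (nabla : CovariantDerivative 𝓘(ℝ, ℂ) ℂ L) (h : X → ℝ)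
    (ε : ℝ) (V : Spinor L) : ℝ≥0∞ :=
  ∫⁻ t in Icc 0 ε, ∫⁻ x,
    ENNReal.ofReal ((‖V.u t x‖ ^ 2 + normSq01 c g x (V.v t x)
      + ‖dtU ε V t x‖ ^ 2 + c / conf g x * ‖dtV ε V t x (e₂ x)‖ ^ 2
      + gradSq g nabla (V.u t) x + gradSq01 c g nabla (V.v t) x) * Real.sqrt (h x)) ∂(area g)

/-- `V` is a measurable section of `𝕊` over `[0, ε] × Σ`. -/
def Spinor.IsMeas (g : Metric X) (ε : ℝ) (V : Spinor L) : Prop :=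
  AEStronglyMeasurable (fun p : ℝ × X ↦ (⟨p.2, V.u p.1 p.2⟩ : TotalSpace ℂ L))
    ((volume.restrict (Icc 0 ε)).prod (area g)) ∧
  AEStronglyMeasurable (fun p : ℝ × X ↦
      (⟨p.2, V.v p.1 p.2⟩ : TotalSpace (ℂ →L[ℝ] ℂ) (fun x : X ↦ Tan x →L[ℝ] L x)))
    ((volume.restrict (Icc 0 ε)).prod (area g)) ∧
  ∀ t ∈ Icc 0 ε, IsForm01 (V.v t)

/-- `V` is in the closure of the smooth sections in the class `T` with respect to the
`L^{1,2}(A_ε, 𝕊)`-norm, and `W = 𝒟 V` in `L²(A_ε, 𝕊)`, where `𝒟` is extended by continuity. For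
`T = TestMinus ε` and `T = TestPlus ε` this is the graph of `𝒟_- : L^{1,2}_- → L²` and of
`𝒟_+ : L^{1,2}_+ → L²`. -/
def DiracGraph (c : ℝ) (g : Metric X) (nabla : CovariantDerivative 𝓘(ℝ, ℂ) ℂ L) (h : X → ℝ)
    (ε : ℝ) (T : Spinor L → Prop) (V W : Spinor L) : Prop :=
  V.IsMeas g ε ∧ W.IsMeas g ε ∧ ∃ s r : ℕ → Spinor L,
    (∀ n, T (s n) ∧ IsDirac c g nabla h ε (s n) (r n)) ∧
    (∀ η : ℝ≥0∞, 0 < η → ∃ N, ∀ m ≥ N, ∀ n ≥ N, ((s m).diff (s n)).sobSq c g nabla h ε < η) ∧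
    Tendsto (fun n ↦ ((s n).diff V).l2Sq c g h ε) atTop (𝓝 0) ∧
    Tendsto (fun n ↦ ((r n).diff W).l2Sq c g h ε) atTop (𝓝 0)

/-- The infimum of `‖𝒟 V‖² / ‖V‖²` over the nonzero `V` in the `L^{1,2}`-closure of the class `T`
of smooth sections. -/
def lamDirac (c : ℝ) (g : Metric X) (nabla : CovariantDerivative 𝓘(ℝ, ℂ) ℂ L) (h : X → ℝ)
    (ε : ℝ) (T : Spinor L → Prop) : ℝ≥0∞ :=
  ⨅ (V : Spinor L) (W : Spinor L) (_ : DiracGraph c g nabla h ε T V W) (_ : V.l2Sq c g h ε ≠ 0),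
    W.l2Sq c g h ε / V.l2Sq c g h ε

end ThinManifold

end

end ThinDirac

/-!
# A lower bound for the Dirac operator on a thin warped cylinder over a Riemann surface

Write `ρ = h^{1/2}`, and for a smooth spinor `V = (u, v)` put `w = ∂̄* v`, `b = ∂̄ u`, with time
derivatives `u'`, `v'`. The volume form carries the weight `ρ` and the Clifford term of `𝒟` the
factor `ρ⁻¹`, so that in `‖𝒟 V‖²` the weights cancel in the mixed terms: pointwise
`ρ |𝒟 V|² = ρ⁻¹ (|u'|² + |v'|²) + ρ (|w|² + |b|²) + 2 Im (⟨u', w⟩ + ⟨b, v'⟩)`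
(`norm_sq_dirac_expand`). As `∂̄` and `∂̄*` are formally adjoint for the unweighted area of the
surface, `∫_Σ (⟨u', w⟩ + ⟨b, v'⟩)` is the time derivative of `∫_Σ ⟨u, w⟩ = ∫_Σ ⟨b, v⟩`, and since
`u` or `v` vanishes at both ends its time integral is zero. No derivatives of `w` and `b` are
needed: the adjointness relation between *different* times `s`, `t` makes it enough to
differentiate `u` and `v` (`integral_pairing_deriv`, `lintegral_dirac_eq`).

Since `K^{-1/2} ≤ ρ, ρ⁻¹` and `ρ ≤ K^{1/2}`, the energy is at least `K^{-1/2} ∫∫ (|b|² + |v'|²)`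
and `‖V‖²` is at most `K^{1/2} ∫∫ (|u|² + |v|²)`. For `𝒟_-` the variational definition of `λ_{∂^-}`
bounds `u` on each slice `{t} × Σ` by `b` (`lamDelMinus_mul_le`), and the Poincaré inequality with
constant `2 / ε²` bounds `v`, which vanishes on the boundary, by `v'` on each segment `[0, ε] × {x}`
(`poincare_inequality`). For `𝒟_+` the roles of `u` and `v` are exchanged. This gives
`‖𝒟 V‖² ≥ K⁻¹ min(λ, 2 / ε²) ‖V‖²` for smooth `V` (`IsDirac.energy_bound`), which is stronger than
the stated inequality because `K ≥ 1` and the `C¹`-norm enters it with a negative sign.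

The bound passes to the `L^{1,2}`-closure by the inequality
`‖A‖² ≤ (1 + η) ‖B‖² + (1 + η⁻¹) ‖A - B‖²` (`DiracGraph.energy_bound`).

All integrals of continuous functions make sense because the area measure is finite
(`isFiniteMeasure_area`): chart areas agree on overlaps by the change of variables formula, and they
are finite on small coordinate discs. Sections of `𝕊⁻` are handled through their values on
coordinate fields (`ContForm`), which are sections of `L`.
-/

set_option linter.unusedSectionVars false

namespace ThinDirac

/-! ### Holomorphic coordinates and the metric -/

section Coordinates

variable {X : Type*} [TopologicalSpace X] [ChartedSpace ℂ X] [IsManifold 𝓘(ℂ) ω X]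

/-- The derivative of a change of holomorphic charts is complex linear. -/
lemma tangentCoordChange_eq_mul {x p y : X} (hx : y ∈ (chartAt ℂ x).source)
    (hp : y ∈ (chartAt ℂ p).source) (a : ℂ) :
    tangentCoordChange 𝓘(ℝ, ℂ) x p y a = a * tangentCoordChange 𝓘(ℝ, ℂ) x p y (1 : ℂ) := by
  have hd : DifferentiableAt ℂ (chartAt ℂ p ∘ (chartAt ℂ x).symm) (chartAt ℂ x y) := by
    have h := (hasFDerivWithinAt_tangentCoordChange (I := 𝓘(ℂ)) (x := x) (y := p) (z := y)
      (by simpa using ⟨hx, hp⟩)).differentiableWithinAt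
    simpa [differentiableWithinAt_univ] using h
  have h2 : tangentCoordChange 𝓘(ℝ, ℂ) x p y
      = fderiv ℝ (chartAt ℂ p ∘ (chartAt ℂ x).symm) (chartAt ℂ x y) := by
    rw [tangentCoordChange_def]; simp
  rw [h2, hd.fderiv_restrictScalars (𝕜 := ℝ)]
  simp [ContinuousLinearMap.coe_restrictScalars']

/-- The coefficient of the coordinate field `∂/∂x₂` of the chart at `p` with respect to the
coordinate vector `e₂ y` of the chart at `y`. -/
noncomputable def coordCoeff (p y : X) : ℂ := tangentCoordChange 𝓘(ℝ, ℂ) p y y (1 : ℂ)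

lemma coordField_eq_mul {p y : X} (hy : y ∈ (chartAt ℂ p).source) (a : ℂ) :
    coordField p a y = (a * coordCoeff p y : ℂ) :=
  tangentCoordChange_eq_mul hy (mem_chart_source ℂ y) a

lemma coordCoeff_change {x p y : X} (hx : y ∈ (chartAt ℂ x).source)
    (hp : y ∈ (chartAt ℂ p).source) :
    coordCoeff x y = tangentCoordChange 𝓘(ℝ, ℂ) x p y (1 : ℂ) * coordCoeff p y := by
  have h := tangentCoordChange_comp (I := 𝓘(ℝ, ℂ)) (w := x) (x := p) (y := y) (z := y)
    (v := (1 : ℂ)) (by simpa using ⟨hx, hp⟩)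
  rw [coordCoeff, ← h]
  exact tangentCoordChange_eq_mul hp (mem_chart_source ℂ y) _

lemma coordCoeff_self (y : X) : coordCoeff y y = 1 :=
  tangentCoordChange_self (I := 𝓘(ℝ, ℂ)) (by simp)

lemma coordCoeff_ne_zero {p y : X} (hy : y ∈ (chartAt ℂ p).source) : coordCoeff p y ≠ 0 := by
  have h := coordCoeff_change (mem_chart_source ℂ y) hy
  rw [coordCoeff_self] at h
  exact right_ne_zero_of_mul (h ▸ one_ne_zero)

lemma conf_pos (g : Metric X) (x : X) : 0 < conf g x :=
  g.pos x _ (one_ne_zero (α := ℂ))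

lemma rotJ_e₂ (y : X) : rotJ y (e₂ y) = e₃ y := by
  change Complex.I • (1 : ℂ) = Complex.I
  simp

/-- A Hermitian metric is a multiple of the standard one in a holomorphic coordinate. -/
lemma IsHermitianMetric.inner_eq {g : Metric X} (hg : IsHermitianMetric g) (y : X) (z w : ℂ) :
    g.inner y (z : ℂ) (w : ℂ) = (z.re * w.re + z.im * w.im) * conf g y := by
  have hJ3 : rotJ y (e₃ y) = - e₂ y := by
    change Complex.I • Complex.I = -(1 : ℂ)
    simp
  have h33 := hg y (e₂ y) (e₂ y)
  rw [rotJ_e₂] at h33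
  have h23 := hg y (e₂ y) (e₃ y)
  rw [rotJ_e₂, hJ3, map_neg, g.symm y (e₃ y)] at h23
  have h23' : g.inner y (e₂ y) (e₃ y) = 0 := by linarith
  have h32' : g.inner y (e₃ y) (e₂ y) = 0 := by rw [g.symm]; exact h23'
  have dec : ∀ z : ℂ, (z : Tan y) = z.re • e₂ y + z.im • e₃ y := by
    intro z
    change z = z.re • (1 : ℂ) + z.im • Complex.I
    apply Complex.ext <;> simp
  have key : g.inner y (z : ℂ) (w : ℂ)
      = g.inner y (z.re • e₂ y + z.im • e₃ y) (w.re • e₂ y + w.im • e₃ y) :=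
    congrArg₂ (fun a b : Tan y ↦ g.inner y a b) (dec z) (dec w)
  rw [key]
  simp only [map_add, map_smul, add_apply, smul_apply, smul_eq_mul, h23', h32', h33, conf]
  ring

lemma metricCoeff_one_one {g : Metric X} (hg : IsHermitianMetric g) {p y : X}
    (hy : y ∈ (chartAt ℂ p).source) :
    metricCoeff g p 1 1 y = Complex.normSq (coordCoeff p y) * conf g y := by
  rw [metricCoeff, coordField_eq_mul hy, hg.inner_eq, Complex.normSq_apply, one_mul]

lemma metricCoeff_one_one_pos {g : Metric X} (hg : IsHermitianMetric g) {p y : X}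
    (hy : y ∈ (chartAt ℂ p).source) : 0 < metricCoeff g p 1 1 y := by
  rw [metricCoeff_one_one hg hy]
  exact mul_pos (Complex.normSq_pos.2 (coordCoeff_ne_zero hy)) (conf_pos g y)

/-- For a Hermitian metric the area density is the conformal factor. -/
lemma areaDensity_eq {g : Metric X} (hg : IsHermitianMetric g) {p y : X}
    (hy : y ∈ (chartAt ℂ p).source) : areaDensity g p y = metricCoeff g p 1 1 y := by
  have h : metricCoeff g p 1 1 y * metricCoeff g p Complex.I Complex.I y
      - metricCoeff g p 1 Complex.I y ^ 2 = metricCoeff g p 1 1 y ^ 2 := by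
    simp only [metricCoeff, coordField_eq_mul hy, hg.inner_eq]
    simp
    ring
  rw [areaDensity, h, Real.sqrt_sq (metricCoeff_one_one_pos hg hy).le]

/-- The coordinate fields of the chart at `p` are smooth on its domain. -/
lemma contMDiffOn_coordField (p : X) (a : ℂ) :
    ContMDiffOn 𝓘(ℝ, ℂ) (𝓘(ℝ, ℂ).prod 𝓘(ℝ, ℂ)) ∞
      (fun y : X ↦ (⟨y, coordField p a y⟩ : TotalSpace ℂ (fun x : X ↦ Tan x)))
      (chartAt ℂ p).source := by
  let e := trivializationAt ℂ (TangentSpace 𝓘(ℝ, ℂ) : X → Type _) p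
  have h := e.contMDiffOn_symm (IB := 𝓘(ℝ, ℂ)) (n := ∞)
  have h2 : ContMDiffOn 𝓘(ℝ, ℂ) (𝓘(ℝ, ℂ).prod 𝓘(ℝ, ℂ)) ∞ (fun y : X ↦ (y, a))
      (chartAt ℂ p).source := contMDiffOn_id.prodMk contMDiffOn_const
  have h3 := h.comp h2 (fun y hy ↦ by
    rw [mem_preimage, e.mem_target]; exact hy)
  refine h3.congr fun y hy ↦ ?_
  have hb : y ∈ e.baseSet := hy
  rw [Function.comp_apply, ← e.mk_symm hb]
  have := DFunLike.congr_fun (TangentBundle.symmL_trivializationAt_eq_core (I := 𝓘(ℝ, ℂ)) hy) a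
  rw [Trivialization.symmL_apply _ hb] at this
  exact congrArg _ this.symm

lemma continuousOn_metricCoeff (g : Metric X) (p : X) (a b : ℂ) :
    ContinuousOn (metricCoeff g p a b) (chartAt ℂ p).source := by
  intro y hy
  have ha := (contMDiffOn_coordField p a).continuousOn y hy
  have hb := (contMDiffOn_coordField p b).continuousOn y hy
  have hG : ContinuousWithinAt (fun y ↦ TotalSpace.mk' (ℂ →L[ℝ] ℂ →L[ℝ] ℝ)
      (E := fun x : X ↦ (Tan x →L[ℝ] Tan x →L[ℝ] ℝ)) y (g.inner y)) (chartAt ℂ p).source y :=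
    g.contMDiff.continuous.continuousWithinAt
  have := ContinuousWithinAt.clm_bundle_apply₂ (F₁ := ℂ) (F₂ := ℂ) (F₃ := ℝ)
    (E₃ := Bundle.Trivial X ℝ) (b := fun y : X ↦ y) hG ha hb
  rw [FiberBundle.continuousWithinAt_totalSpace] at this
  exact this.2

end Coordinates

/-! ### The area of a compact surface is finite -/

lemma det_real_complex (A : ℂ →L[ℝ] ℂ) :
    A.det = (A 1).re * (A Complex.I).im - (A 1).im * (A Complex.I).re := by
  rw [ContinuousLinearMap.det, ← LinearMap.det_toMatrix Complex.basisOneI, Matrix.det_fin_two]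
  simp [LinearMap.toMatrix_apply]
  ring

section Area

variable {X : Type*} [TopologicalSpace X] [ChartedSpace ℂ X] [IsManifold 𝓘(ℂ) ω X]

lemma areaDensity_change {g : Metric X} (hg : IsHermitianMetric g) {x p y : X}
    (hx : y ∈ (chartAt ℂ x).source) (hp : y ∈ (chartAt ℂ p).source) :
    areaDensity g x y = |(tangentCoordChange 𝓘(ℝ, ℂ) x p y).det| * areaDensity g p y := by
  have hI := tangentCoordChange_eq_mul hx hp Complex.I
  have hdet : (tangentCoordChange 𝓘(ℝ, ℂ) x p y).det
      = Complex.normSq (tangentCoordChange 𝓘(ℝ, ℂ) x p y (1 : ℂ)) := by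
    rw [det_real_complex, hI, Complex.normSq_apply]
    simp
  rw [areaDensity_eq hg hx, areaDensity_eq hg hp, metricCoeff_one_one hg hx,
    metricCoeff_one_one hg hp, coordCoeff_change hx hp, Complex.normSq_mul, hdet,
    abs_of_nonneg (Complex.normSq_nonneg _), mul_assoc]

variable [MeasurableSpace X] [BorelSpace X]

lemma chartArea_apply (g : Metric X) (x : X) {S : Set X} (hS : MeasurableSet S) :
    chartArea g x S = ∫⁻ z in (chartAt ℂ x).target ∩ (chartAt ℂ x).symm ⁻¹' S,
      ENNReal.ofReal (areaDensity g x ((chartAt ℂ x).symm z)) := by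
  have ht : MeasurableSet (chartAt ℂ x).target := (chartAt ℂ x).open_target.measurableSet
  have hm : AEMeasurable (chartAt ℂ x).symm
      ((volume.restrict (chartAt ℂ x).target).withDensity
        (fun z ↦ ENNReal.ofReal (areaDensity g x ((chartAt ℂ x).symm z)))) :=
    ((chartAt ℂ x).continuousOn_symm.aemeasurable ht).mono_ac (withDensity_absolutelyContinuous _ _)
  rw [chartArea, Measure.map_apply_of_aemeasurable hm hS, withDensity_apply',
    Measure.restrict_restrict' ht, inter_comm]

lemma measurableSet_target_inter_preimage (x : X) {S : Set X} (hS : MeasurableSet S) :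
    MeasurableSet ((chartAt ℂ x).target ∩ (chartAt ℂ x).symm ⁻¹' S) := by
  have ht : MeasurableSet (chartAt ℂ x).target := (chartAt ℂ x).open_target.measurableSet
  have := (continuousOn_iff_continuous_domRestrict.1 (chartAt ℂ x).continuousOn_symm).measurable hS
  convert ht.subtype_image this using 1
  ext z
  simp [and_comm]

/-- The area measures of two charts agree on the intersection of the two chart domains; only one
inequality is recorded, as both charts may be exchanged. -/
lemma chartArea_le {g : Metric X} (hg : IsHermitianMetric g) (x p : X) {S : Set X}
    (hS : MeasurableSet S) (hSp : S ⊆ (chartAt ℂ p).source) :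
    chartArea g x S ≤ chartArea g p S := by
  rw [chartArea_apply g x hS, chartArea_apply g p hS]
  set T := (chartAt ℂ x).target ∩ (chartAt ℂ x).symm ⁻¹' S with hT
  have hTm : MeasurableSet T := measurableSet_target_inter_preimage x hS
  have hsrc : ∀ z ∈ T, (chartAt ℂ x).symm z ∈ (chartAt ℂ x).source := fun z hz ↦
    (chartAt ℂ x).map_target hz.1
  have hsrc' : ∀ z ∈ T, (chartAt ℂ x).symm z ∈ (chartAt ℂ p).source := fun z hz ↦ hSp hz.2
  have hder : ∀ z ∈ T, HasFDerivWithinAt (chartAt ℂ p ∘ (chartAt ℂ x).symm)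
      (tangentCoordChange 𝓘(ℝ, ℂ) x p ((chartAt ℂ x).symm z)) T z := by
    intro z hz
    have h := hasFDerivWithinAt_tangentCoordChange (I := 𝓘(ℝ, ℂ)) (x := x) (y := p)
      (z := (chartAt ℂ x).symm z) (by simpa using ⟨hsrc z hz, hsrc' z hz⟩)
    have h2 : extChartAt 𝓘(ℝ, ℂ) x ((chartAt ℂ x).symm z) = z := by
      simp [(chartAt ℂ x).right_inv hz.1]
    rw [h2] at h
    refine (h.mono (by simp) : HasFDerivWithinAt _ _ T z).congr (fun w _ ↦ ?_) ?_ <;> simp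
  have hinj : InjOn (chartAt ℂ p ∘ (chartAt ℂ x).symm) T :=
    (chartAt ℂ p).injOn.comp ((chartAt ℂ x).symm.injOn.mono fun z hz ↦ hz.1)
      (fun z hz ↦ hsrc' z hz)
  have hcv := lintegral_image_eq_lintegral_abs_det_fderiv_mul volume hTm hder hinj
    (fun z ↦ ENNReal.ofReal (areaDensity g p ((chartAt ℂ p).symm z)))
  have himg : (chartAt ℂ p ∘ (chartAt ℂ x).symm) '' T
      ⊆ (chartAt ℂ p).target ∩ (chartAt ℂ p).symm ⁻¹' S := by
    rintro _ ⟨z, hz, rfl⟩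
    refine ⟨(chartAt ℂ p).map_source (hsrc' z hz), ?_⟩
    rw [mem_preimage, Function.comp_apply, (chartAt ℂ p).left_inv (hsrc' z hz)]
    exact hz.2
  refine le_trans (le_of_eq ?_) (lintegral_mono_set himg)
  rw [hcv]
  refine setLIntegral_congr_fun hTm fun z hz ↦ ?_
  simp only [Function.comp_apply]
  rw [(chartAt ℂ p).left_inv (hsrc' z hz), ← ENNReal.ofReal_mul (abs_nonneg _),
    areaDensity_change hg (hsrc z hz) (hsrc' z hz)]

lemma area_le_chartArea {g : Metric X} (hg : IsHermitianMetric g) (p : X) {S : Set X}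
    (hS : MeasurableSet S) (hSp : S ⊆ (chartAt ℂ p).source) :
    area g S ≤ chartArea g p S := by
  have h : area g ≤ (chartArea g p).restrict S + (⊤ : Measure X).restrict Sᶜ := by
    refine iSup_le fun x ↦ ?_
    calc chartArea g x = (chartArea g x).restrict S + (chartArea g x).restrict Sᶜ :=
          (Measure.restrict_add_restrict_compl hS).symm
      _ ≤ _ := by
        refine add_le_add (Measure.le_iff.2 fun A hA ↦ ?_) (Measure.restrict_mono subset_rfl le_top)
        rw [Measure.restrict_apply hA, Measure.restrict_apply hA]
        exact chartArea_le hg x p (hA.inter hS) (inter_subset_right.trans hSp)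
  refine (h S).trans (le_of_eq ?_)
  simp [Measure.restrict_apply hS]

/-- The area measure is finite near every point: in a small closed coordinate disc it is
given by a bounded density. -/
lemma isFiniteMeasure_area [CompactSpace X] {g : Metric X} (hg : IsHermitianMetric g) :
    IsFiniteMeasure (area g) := by
  suffices h : ∀ p : X, ∃ S ∈ 𝓝 p, area g S < ⊤ from
    have : IsLocallyFiniteMeasure (area g) := ⟨h⟩
    inferInstance
  intro p
  have hp := mem_chart_source ℂ p
  have hd : ContinuousOn (fun y ↦ areaDensity g p y) (chartAt ℂ p).source :=
    (continuousOn_metricCoeff g p 1 1).congr fun y hy ↦ areaDensity_eq hg hy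
  obtain ⟨r, hr, hball⟩ := Metric.nhds_basis_closedBall.mem_iff.1
    ((chartAt ℂ p).open_target.mem_nhds ((chartAt ℂ p).map_source hp))
  set B := Metric.closedBall (chartAt ℂ p p) r with hB
  have hBc : IsCompact B := isCompact_closedBall _ _
  have hcont : ContinuousOn (fun z ↦ areaDensity g p ((chartAt ℂ p).symm z)) B :=
    hd.comp ((chartAt ℂ p).continuousOn_symm.mono hball) fun z hz ↦
      (chartAt ℂ p).map_target (hball hz)
  obtain ⟨C, hC⟩ := hBc.exists_bound_of_continuousOn hcont
  let S : Set X := (chartAt ℂ p).source ∩ chartAt ℂ p ⁻¹' Metric.ball (chartAt ℂ p p) r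
  have hSo : IsOpen S := (chartAt ℂ p).isOpen_inter_preimage Metric.isOpen_ball
  refine ⟨S, hSo.mem_nhds ⟨hp, Metric.mem_ball_self hr⟩, ?_⟩
  refine (area_le_chartArea hg p hSo.measurableSet inter_subset_left).trans_lt ?_
  rw [chartArea_apply g p hSo.measurableSet]
  have hsub : (chartAt ℂ p).target ∩ (chartAt ℂ p).symm ⁻¹' S ⊆ B := by
    rintro z ⟨hz, -, hz2⟩
    rw [mem_preimage, (chartAt ℂ p).right_inv hz] at hz2
    exact Metric.ball_subset_closedBall hz2
  calc _ ≤ ∫⁻ z in B, ENNReal.ofReal (areaDensity g p ((chartAt ℂ p).symm z)) :=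
        lintegral_mono_set hsub
    _ ≤ ∫⁻ _ in B, ENNReal.ofReal C :=
        setLIntegral_mono measurable_const fun z hz ↦
          ENNReal.ofReal_le_ofReal ((le_abs_self _).trans (hC z hz))
    _ < ⊤ := by
        rw [setLIntegral_const]
        exact ENNReal.mul_lt_top ENNReal.ofReal_lt_top hBc.measure_lt_top

end Area

/-! ### Continuity of sections and of the fibre metrics -/

section Sections

variable {X : Type*} [TopologicalSpace X]
  {L : X → Type*} [TopologicalSpace (TotalSpace ℂ L)]
  [∀ x, NormedAddCommGroup (L x)] [∀ x, InnerProductSpace ℂ (L x)]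
  [FiberBundle ℂ L]
  {M : Type*} [TopologicalSpace M] {b : M → X} {s : Set M} {m : M} {α β : ∀ m, L (b m)}

lemma continuousWithinAt_add_section [VectorBundle ℂ ℂ L]
    (hα : ContinuousWithinAt (fun m ↦ (⟨b m, α m⟩ : TotalSpace ℂ L)) s m)
    (hβ : ContinuousWithinAt (fun m ↦ (⟨b m, β m⟩ : TotalSpace ℂ L)) s m) :
    ContinuousWithinAt (fun m ↦ (⟨b m, α m + β m⟩ : TotalSpace ℂ L)) s m := by
  rw [FiberBundle.continuousWithinAt_totalSpace] at hα hβ ⊢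
  refine ⟨hα.1, ?_⟩
  have hb : ∀ m', b m' ∈ (trivializationAt ℂ L (b m)).baseSet →
      ((trivializationAt ℂ L (b m)) ⟨b m', α m' + β m'⟩).2
        = ((trivializationAt ℂ L (b m)) ⟨b m', α m'⟩).2
          + ((trivializationAt ℂ L (b m)) ⟨b m', β m'⟩).2 := fun m' hm' ↦
    ((trivializationAt ℂ L (b m)).linear ℂ hm').map_add _ _
  refine (hα.2.add hβ.2).congr_of_eventuallyEq ?_
    (hb m (FiberBundle.mem_baseSet_trivializationAt' _))
  filter_upwards [hα.1.preimage_mem_nhdsWithin ((trivializationAt ℂ L (b m)).open_baseSet.mem_nhds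
    (FiberBundle.mem_baseSet_trivializationAt' _))] with m' hm' using hb m' hm'

lemma continuousWithinAt_smul_section [VectorBundle ℂ ℂ L] {f : M → ℂ}
    (hf : ContinuousWithinAt f s m)
    (hα : ContinuousWithinAt (fun m ↦ (⟨b m, α m⟩ : TotalSpace ℂ L)) s m) :
    ContinuousWithinAt (fun m ↦ (⟨b m, f m • α m⟩ : TotalSpace ℂ L)) s m := by
  rw [FiberBundle.continuousWithinAt_totalSpace] at hα ⊢
  refine ⟨hα.1, ?_⟩
  have hb : ∀ m', b m' ∈ (trivializationAt ℂ L (b m)).baseSet →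
      ((trivializationAt ℂ L (b m)) ⟨b m', f m' • α m'⟩).2
        = f m' • ((trivializationAt ℂ L (b m)) ⟨b m', α m'⟩).2 := fun m' hm' ↦
    ((trivializationAt ℂ L (b m)).linear ℂ hm').map_smul _ _
  refine (hf.smul hα.2).congr_of_eventuallyEq ?_
    (hb m (FiberBundle.mem_baseSet_trivializationAt' _))
  filter_upwards [hα.1.preimage_mem_nhdsWithin ((trivializationAt ℂ L (b m)).open_baseSet.mem_nhds
    (FiberBundle.mem_baseSet_trivializationAt' _))] with m' hm' using hb m' hm'

end Sections

section Metric

variable {X : Type*} [TopologicalSpace X] [ChartedSpace ℂ X] [IsManifold 𝓘(ℂ) ω X]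
  {L : X → Type*} [TopologicalSpace (TotalSpace ℂ L)]
  [∀ x, NormedAddCommGroup (L x)] [∀ x, InnerProductSpace ℂ (L x)]
  [FiberBundle ℂ L] [VectorBundle ℝ ℂ L]
  {M : Type*} [TopologicalSpace M] {b : M → X} {s : Set M} {m : M} {α β : ∀ m, L (b m)}

lemma IsSmoothHermitian.continuousWithinAt_re_inner (hL : IsSmoothHermitian L)
    (hα : ContinuousWithinAt (fun m ↦ (⟨b m, α m⟩ : TotalSpace ℂ L)) s m)
    (hβ : ContinuousWithinAt (fun m ↦ (⟨b m, β m⟩ : TotalSpace ℂ L)) s m) :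
    ContinuousWithinAt (fun m ↦ (inner ℂ (α m) (β m)).re) s m := by
  obtain ⟨G, hG, hGi⟩ := hL
  have hb : ContinuousWithinAt b s m := by
    rw [FiberBundle.continuousWithinAt_totalSpace] at hα
    exact hα.1
  have hG' : ContinuousWithinAt (fun m ↦ TotalSpace.mk' (ℂ →L[ℝ] ℂ →L[ℝ] ℝ)
      (E := fun x : X ↦ (L x →L[ℝ] L x →L[ℝ] ℝ)) (b m) (G (b m))) s m :=
    ContinuousAt.comp_continuousWithinAt (f := b) hG.continuous.continuousAt hb
  have := ContinuousWithinAt.clm_bundle_apply₂ (F₁ := ℂ) (F₂ := ℂ) (F₃ := ℝ)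
    (E₃ := Bundle.Trivial X ℝ) (b := b) hG' hα hβ
  rw [FiberBundle.continuousWithinAt_totalSpace] at this
  refine this.2.congr (fun y _ ↦ ?_) ?_ <;> exact (hGi _ _ _).symm

/-- The full Hermitian product is recovered from its real part by inserting `i` times the first
argument. -/
lemma IsSmoothHermitian.continuousWithinAt_inner [VectorBundle ℂ ℂ L] (hL : IsSmoothHermitian L)
    (hα : ContinuousWithinAt (fun m ↦ (⟨b m, α m⟩ : TotalSpace ℂ L)) s m)
    (hβ : ContinuousWithinAt (fun m ↦ (⟨b m, β m⟩ : TotalSpace ℂ L)) s m) :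
    ContinuousWithinAt (fun m ↦ inner ℂ (α m) (β m)) s m := by
  have h1 := hL.continuousWithinAt_re_inner hα hβ
  have h2 := hL.continuousWithinAt_re_inner
    (continuousWithinAt_smul_section (continuousWithinAt_const (b := Complex.I)) hα) hβ
  have h3 : ContinuousWithinAt (fun m ↦ (((inner ℂ (α m) (β m)).re : ℝ) : ℂ)
      + (((inner ℂ (Complex.I • α m) (β m)).re : ℝ) : ℂ) * Complex.I) s m :=
    (Complex.continuous_ofReal.continuousAt.comp_continuousWithinAt h1).add
      ((Complex.continuous_ofReal.continuousAt.comp_continuousWithinAt h2).mul_const _)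
  refine h3.congr (fun y _ ↦ ?_) ?_ <;>
  · apply Complex.ext <;> simp

lemma IsSmoothHermitian.continuousWithinAt_norm_sq [VectorBundle ℂ ℂ L]
    (hL : IsSmoothHermitian L)
    (hα : ContinuousWithinAt (fun m ↦ (⟨b m, α m⟩ : TotalSpace ℂ L)) s m) :
    ContinuousWithinAt (fun m ↦ ‖α m‖ ^ 2) s m := by
  refine (hL.continuousWithinAt_re_inner hα hα).congr (fun y _ ↦ ?_) ?_ <;>
  · rw [← inner_self_eq_norm_sq (𝕜 := ℂ)]
    rfl

lemma IsSmoothHermitian.continuous_norm_sq [VectorBundle ℂ ℂ L] (hL : IsSmoothHermitian L) :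
    Continuous (fun l : TotalSpace ℂ L ↦ ‖l.2‖ ^ 2) := by
  rw [← continuousOn_univ]
  intro l _
  exact hL.continuousWithinAt_norm_sq (b := fun l : TotalSpace ℂ L ↦ l.1) (α := fun l ↦ l.2)
    continuousWithinAt_id

end Metric

section Forms

variable {X : Type*} [TopologicalSpace X] [ChartedSpace ℂ X] [IsManifold 𝓘(ℂ) ω X]

/-- The Hilbert-Schmidt norm of a real linear map out of a tangent plane with a Hermitian metric
does not depend on the choice of the holomorphic coordinate. -/
lemma frame_sum_eq {E : Type*} [NormedAddCommGroup E] [InnerProductSpace ℂ E]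
    {g : Metric X} (hg : IsHermitianMetric g) {p y : X}
    (hy : y ∈ (chartAt ℂ p).source) (a : Tan y →L[ℝ] E) :
    (‖a (e₂ y)‖ ^ 2 + ‖a (e₃ y)‖ ^ 2) / conf g y
      = (‖a (coordField p 1 y)‖ ^ 2 + ‖a (coordField p Complex.I y)‖ ^ 2)
        / metricCoeff g p 1 1 y := by
  have h1 : coordField p 1 y = (coordCoeff p y).re • e₂ y + (coordCoeff p y).im • e₃ y := by
    rw [coordField_eq_mul hy]
    change (1 * coordCoeff p y : ℂ) = (coordCoeff p y).re • (1 : ℂ)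
      + (coordCoeff p y).im • Complex.I
    apply Complex.ext <;> simp
  have h2 : coordField p Complex.I y
      = (-(coordCoeff p y).im) • e₂ y + (coordCoeff p y).re • e₃ y := by
    rw [coordField_eq_mul hy]
    change (Complex.I * coordCoeff p y : ℂ) = (-(coordCoeff p y).im) • (1 : ℂ)
      + (coordCoeff p y).re • Complex.I
    apply Complex.ext <;> simp
  have key : ∀ (r t : ℝ) (A B : E), ‖r • A + t • B‖ ^ 2
      = r ^ 2 * ‖A‖ ^ 2 + 2 * (r * t) * (inner ℂ A B).re + t ^ 2 * ‖B‖ ^ 2 := by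
    intro r t A B
    rw [← Complex.coe_smul r, ← Complex.coe_smul t, norm_add_sq (𝕜 := ℂ), inner_smul_left,
      inner_smul_right, norm_smul, norm_smul, mul_pow, mul_pow]
    simp
    ring
  have hn := Complex.normSq_pos.2 (coordCoeff_ne_zero hy)
  rw [metricCoeff_one_one hg hy, h1, h2, map_add, map_add, map_smul, map_smul, map_smul, map_smul,
    key, key, div_eq_div_iff (conf_pos g y).ne' (mul_pos hn (conf_pos g y)).ne',
    Complex.normSq_apply]
  ring

variable {L : X → Type*} [TopologicalSpace (TotalSpace ℂ L)]
  [∀ x, NormedAddCommGroup (L x)] [∀ x, InnerProductSpace ℂ (L x)]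
  [FiberBundle ℂ L]

section

variable [VectorBundle ℝ ℂ L]

lemma normSq01_eq_frame_sum (c : ℝ) (g : Metric X) (y : X) {a : Tan y →L[ℝ] L y}
    (ha : ∀ ξ, a (rotJ y ξ) = -(Complex.I • a ξ)) :
    normSq01 c g y a = c / 2 * ((‖a (e₂ y)‖ ^ 2 + ‖a (e₃ y)‖ ^ 2) / conf g y) := by
  have := ha (e₂ y)
  rw [rotJ_e₂] at this
  rw [normSq01, this, norm_neg, norm_smul, Complex.norm_I, one_mul]
  ring

/-- A continuous function on the bundle `Hom(TΣ, L)` which on antilinear maps is their squared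
length `normSq01`. -/
lemma IsSmoothHermitian.continuous_frame_sum [VectorBundle ℂ ℂ L] (hL : IsSmoothHermitian L)
    (c : ℝ) {g : Metric X} (hg : IsHermitianMetric g) :
    Continuous (fun A : TotalSpace (ℂ →L[ℝ] ℂ) (fun x : X ↦ Tan x →L[ℝ] L x) ↦
      c / 2 * ((‖A.2 (e₂ A.1)‖ ^ 2 + ‖A.2 (e₃ A.1)‖ ^ 2) / conf g A.1)) := by
  rw [continuous_iff_continuousAt]
  intro A₀
  have hproj : ContinuousAt (fun A : TotalSpace (ℂ →L[ℝ] ℂ) (fun x : X ↦ Tan x →L[ℝ] L x) ↦ A.1)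
      A₀ :=
    (FiberBundle.continuous_proj (ℂ →L[ℝ] ℂ) (fun x : X ↦ Tan x →L[ℝ] L x)).continuousAt
  have hnhds := (chartAt ℂ A₀.1).open_source.mem_nhds (mem_chart_source ℂ A₀.1)
  have hev : ∀ ξ : ℂ, ContinuousAt
      (fun A : TotalSpace (ℂ →L[ℝ] ℂ) (fun x : X ↦ Tan x →L[ℝ] L x) ↦
        ‖A.2 (coordField A₀.1 ξ A.1)‖ ^ 2) A₀ := by
    intro ξ
    have hξ : ContinuousAt (fun A : TotalSpace (ℂ →L[ℝ] ℂ) (fun x : X ↦ Tan x →L[ℝ] L x) ↦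
        TotalSpace.mk' ℂ (E := fun x : X ↦ Tan x) A.1 (coordField A₀.1 ξ A.1)) A₀ :=
      ContinuousAt.comp (f := fun A : TotalSpace (ℂ →L[ℝ] ℂ) (fun x : X ↦ Tan x →L[ℝ] L x) ↦ A.1)
        ((contMDiffOn_coordField A₀.1 ξ).continuousOn.continuousAt hnhds) hproj
    have := ContinuousAt.clm_bundle_apply (F₁ := ℂ) (F₂ := ℂ) (E₁ := fun x : X ↦ Tan x) (E₂ := L)
      (b := fun A : TotalSpace (ℂ →L[ℝ] ℂ) (fun x : X ↦ Tan x →L[ℝ] L x) ↦ A.1)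
      (ϕ := fun A ↦ A.2) (continuousAt_id (x := A₀)) hξ
    exact hL.continuous_norm_sq.continuousAt.comp this
  have hm : ContinuousAt (fun A : TotalSpace (ℂ →L[ℝ] ℂ) (fun x : X ↦ Tan x →L[ℝ] L x) ↦
      metricCoeff g A₀.1 1 1 A.1) A₀ :=
    ContinuousAt.comp (f := fun A : TotalSpace (ℂ →L[ℝ] ℂ) (fun x : X ↦ Tan x →L[ℝ] L x) ↦ A.1)
      ((continuousOn_metricCoeff g A₀.1 1 1).continuousAt hnhds) hproj
  refine ((continuousAt_const (y := c / 2)).mul (((hev 1).add (hev Complex.I)).div hm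
    (metricCoeff_one_one_pos hg (mem_chart_source ℂ A₀.1)).ne')).congr ?_
  filter_upwards [hproj.preimage_mem_nhds hnhds] with A hA
  rw [frame_sum_eq hg hA]
  rfl

end

variable {M N : Type*} [TopologicalSpace M] [TopologicalSpace N] {b : M → X} {s : Set M}
  {β γ : ∀ m, Tan (b m) → L (b m)}

/-- `β` is a continuous family over `s ⊆ M` of antilinear maps `Tan (b m) → L (b m)`. Continuity is
tested by inserting the coordinate fields of the charts of the surface. -/
structure ContForm (b : M → X) (s : Set M) (β : ∀ m, Tan (b m) → L (b m)) : Prop where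
  anti : ∀ m ∈ s, ∀ a : ℂ, β m (a : ℂ) = (starRingEnd ℂ) a • β m (e₂ (b m))
  base : ContinuousOn b s
  cont : ∀ p : X, ∀ m ∈ s, b m ∈ (chartAt ℂ p).source → ContinuousWithinAt
    (fun m ↦ (⟨b m, β m (coordField p 1 (b m))⟩ : TotalSpace ℂ L)) s m

lemma ContForm.comp (hβ : ContForm b s β) {φ : N → M} {t : Set N} (hφ : ContinuousOn φ t)
    (hst : MapsTo φ t s) : ContForm (b ∘ φ) t (fun n ↦ β (φ n)) where
  anti n hn := hβ.anti (φ n) (hst hn)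
  base := hβ.base.comp hφ hst
  cont p n hn hp := ContinuousWithinAt.comp (f := φ) (hβ.cont p (φ n) (hst hn) hp) (hφ n hn) hst

lemma ContForm.add [VectorBundle ℂ ℂ L] (hβ : ContForm b s β) (hγ : ContForm b s γ) :
    ContForm b s (fun m a ↦ β m a + γ m a) where
  anti m hm a := by rw [hβ.anti m hm, hγ.anti m hm, smul_add]
  base := hβ.base
  cont p m hm hp := continuousWithinAt_add_section (hβ.cont p m hm hp) (hγ.cont p m hm hp)

lemma ContForm.smul [VectorBundle ℂ ℂ L] (hβ : ContForm b s β) {f : M → ℂ}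
    (hf : ContinuousOn f s) : ContForm b s (fun m a ↦ f m • β m a) where
  anti m hm a := by rw [hβ.anti m hm, smul_comm]
  base := hβ.base
  cont p m hm hp := continuousWithinAt_smul_section (hf m hm) (hβ.cont p m hm hp)

lemma ContForm.congr (hβ : ContForm b s β) (h : ∀ m ∈ s, ∀ a, γ m a = β m a) :
    ContForm b s γ where
  anti m hm a := (h m hm a).trans ((hβ.anti m hm a).trans (by rw [h m hm]))
  base := hβ.base
  cont p m hm hp := (hβ.cont p m hm hp).congr (fun m' hm' ↦ by rw [h m' hm'])
    (by rw [h m hm])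

lemma ContForm.inner [VectorBundle ℝ ℂ L] [VectorBundle ℂ ℂ L] (hL : IsSmoothHermitian L)
    (c : ℝ) {g : Metric X} (hg : IsHermitianMetric g) (hβ : ContForm b s β) (hγ : ContForm b s γ) :
    ContinuousOn (fun m ↦ ((c / conf g (b m) : ℝ) : ℂ) *
      inner ℂ (β m (e₂ (b m))) (γ m (e₂ (b m)))) s := by
  intro m hm
  -- The numbers `conf g (b m')` and the vectors `e₂ (b m')` refer to a chart which varies with
  -- `m'`; by antilinearity the product may be computed in the fixed chart at `b m` instead.
  have hsrc := mem_chart_source ℂ (b m)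
  have h1 := hL.continuousWithinAt_inner (hβ.cont (b m) m hm hsrc) (hγ.cont (b m) m hm hsrc)
  have h2 : ContinuousWithinAt (fun m' ↦ ((c / metricCoeff g (b m) 1 1 (b m') : ℝ) : ℂ)) s m := by
    refine Complex.continuous_ofReal.continuousAt.comp_continuousWithinAt ?_
    refine continuousWithinAt_const.div ?_ (metricCoeff_one_one_pos hg hsrc).ne'
    exact ContinuousAt.comp_continuousWithinAt (f := b)
      ((continuousOn_metricCoeff g (b m) 1 1).continuousAt
        ((chartAt ℂ (b m)).open_source.mem_nhds hsrc)) (hβ.base m hm)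
  have heq : ∀ m' ∈ s, b m' ∈ (chartAt ℂ (b m)).source →
      ((c / conf g (b m') : ℝ) : ℂ) * Inner.inner ℂ (β m' (e₂ (b m'))) (γ m' (e₂ (b m')))
      = ((c / metricCoeff g (b m) 1 1 (b m') : ℝ) : ℂ) * Inner.inner ℂ
        (β m' (coordField (b m) 1 (b m'))) (γ m' (coordField (b m) 1 (b m'))) := by
    intro m' hm' hb
    have hn := Complex.normSq_pos.2 (coordCoeff_ne_zero hb)
    rw [metricCoeff_one_one hg hb, coordField_eq_mul hb, one_mul, hβ.anti m' hm', hγ.anti m' hm',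
      inner_smul_left, inner_smul_right, Complex.conj_conj]
    have h3 : coordCoeff (b m) (b m') * (starRingEnd ℂ) (coordCoeff (b m) (b m'))
      = (Complex.normSq (coordCoeff (b m) (b m')) : ℂ) := Complex.mul_conj _
    have h4 : (Complex.normSq (coordCoeff (b m) (b m')) : ℂ) ≠ 0 := by exact_mod_cast hn.ne'
    have h5 : (conf g (b m') : ℂ) ≠ 0 := by exact_mod_cast (conf_pos g (b m')).ne'
    rw [← mul_assoc, ← mul_assoc, mul_assoc _ (coordCoeff _ _), h3]
    push_cast
    field_simp
  refine (h2.mul h1).congr_of_eventuallyEq ?_ (heq m hm hsrc)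
  filter_upwards [self_mem_nhdsWithin, (hβ.base m hm).preimage_mem_nhdsWithin
    ((chartAt ℂ (b m)).open_source.mem_nhds hsrc)] with m' h1 h2 using heq m' h1 h2

/-- An antilinear map is determined by its value on `e₂`. -/
lemma antilinear_apply {y : X} {a : Tan y →L[ℝ] L y}
    (ha : ∀ ξ, a (rotJ y ξ) = -(Complex.I • a ξ)) (z : ℂ) :
    a (z : ℂ) = (starRingEnd ℂ) z • a (e₂ y) := by
  have h3 := ha (e₂ y)
  rw [rotJ_e₂] at h3
  have dec : (z : Tan y) = z.re • e₂ y + z.im • e₃ y := by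
    change z = z.re • (1 : ℂ) + z.im • Complex.I
    apply Complex.ext <;> simp
  have h4 : a (z : ℂ) = a (z.re • e₂ y + z.im • e₃ y) := congrArg (fun ξ : Tan y ↦ a ξ) dec
  rw [h4, map_add, map_smul, map_smul, h3, ← Complex.coe_smul, ← Complex.coe_smul, smul_neg,
    smul_smul, ← sub_eq_add_neg, ← sub_smul]
  congr 1
  apply Complex.ext <;> simp

lemma contForm_of_continuousOn [VectorBundle ℝ ℂ L] {B : ∀ m, Tan (b m) →L[ℝ] L (b m)}
    (hB : ContinuousOn (fun m ↦ (⟨b m, B m⟩ :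
      TotalSpace (ℂ →L[ℝ] ℂ) (fun x : X ↦ Tan x →L[ℝ] L x))) s)
    (hanti : ∀ m ∈ s, ∀ ξ, B m (rotJ (b m) ξ) = -(Complex.I • B m ξ)) :
    ContForm b s (fun m a ↦ B m a) where
  anti m hm a := antilinear_apply (hanti m hm) a
  base m hm := by
    have := hB m hm
    rw [FiberBundle.continuousWithinAt_totalSpace] at this
    exact this.1
  cont p m hm hp := by
    have hb : ContinuousWithinAt b s m := by
      have := hB m hm
      rw [FiberBundle.continuousWithinAt_totalSpace] at this
      exact this.1
    have hξ : ContinuousWithinAt (fun m ↦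
        TotalSpace.mk' ℂ (E := fun x : X ↦ Tan x) (b m) (coordField p 1 (b m))) s m :=
      ContinuousAt.comp_continuousWithinAt (f := b)
        ((contMDiffOn_coordField p 1).continuousOn.continuousAt
          ((chartAt ℂ p).open_source.mem_nhds hp)) hb
    exact ContinuousWithinAt.clm_bundle_apply (F₁ := ℂ) (F₂ := ℂ) (E₁ := fun x : X ↦ Tan x)
      (E₂ := L) (b := b) (ϕ := B) (hB m hm) hξ

/-- A section of `Hom(TΣ, L)` with antilinear values is continuous as soon as it is
continuous on coordinate fields. -/
lemma ContForm.continuous_section [VectorBundle ℝ ℂ L] [VectorBundle ℂ ℂ L]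
    {B : ∀ x : X, Tan x →L[ℝ] L x} (hB : ContForm (fun x : X ↦ x) univ (fun x a ↦ B x a)) :
    Continuous (fun x ↦ (⟨x, B x⟩ :
      TotalSpace (ℂ →L[ℝ] ℂ) (fun x : X ↦ Tan x →L[ℝ] L x))) := by
  rw [continuous_iff_continuousAt]
  intro p
  rw [continuousAt_hom_bundle]
  refine ⟨continuousAt_id, continuousAt_clm_apply.2 fun a ↦ ?_⟩
  have hp := mem_chart_source ℂ p
  have h1 : ContinuousWithinAt (fun x ↦
      (⟨x, (starRingEnd ℂ) a • B x (coordField p 1 x)⟩ : TotalSpace ℂ L)) univ p :=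
    continuousWithinAt_smul_section (b := fun x : X ↦ x) continuousWithinAt_const
      (hB.cont p p (mem_univ p) hp)
  rw [FiberBundle.continuousWithinAt_totalSpace] at h1
  refine ContinuousAt.congr ((continuousWithinAt_univ _ _).1 h1.2) ?_
  filter_upwards [(chartAt ℂ p).open_source.mem_nhds hp,
    (trivializationAt ℂ L p).open_baseSet.mem_nhds (FiberBundle.mem_baseSet_trivializationAt' p)]
    with x hx hx2
  have h3 : (starRingEnd ℂ) a • B x (coordField p 1 x) = B x (coordField p a x) := by
    have h4 : B x (coordField p 1 x) = (starRingEnd ℂ) (coordCoeff p x) • B x (e₂ x) := by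
      rw [coordField_eq_mul hx, one_mul]
      exact hB.anti x (mem_univ x) _
    have h5 : B x (coordField p a x) = (starRingEnd ℂ) (a * coordCoeff p x) • B x (e₂ x) := by
      rw [coordField_eq_mul hx a]
      exact hB.anti x (mem_univ x) _
    rw [h4, h5, map_mul, smul_smul]
  have h6 := DFunLike.congr_fun
    (TangentBundle.symmL_trivializationAt_eq_core (I := 𝓘(ℝ, ℂ)) hx) a
  simp only [ContinuousLinearMap.inCoordinates, ContinuousLinearMap.comp_apply]
  rw [h3, Trivialization.continuousLinearMapAt_apply, Trivialization.coe_linearMapAt_of_mem _ hx2]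
  have h7 : (Trivialization.symmL ℝ (trivializationAt ℂ (TangentSpace 𝓘(ℝ, ℂ)) p) x) a
    = coordField p a x := h6
  rw [h7]

end Forms

/-! ### The derivative in the interval direction -/

section TimeDerivative

variable {X : Type*} [TopologicalSpace X] [ChartedSpace ℂ X] [IsManifold 𝓘(ℂ) ω X]

/-- A smooth function on `[0, ε] × V`, for an open set `V` of the surface, has a continuous partial
derivative with respect to the first variable. -/
lemma exists_partial_deriv {ε : ℝ} (hε : 0 < ε) {V : Set X} (hV : IsOpen V) {p : X}
    (hVp : V ⊆ (chartAt ℂ p).source) {f : ℝ × X → ℂ}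
    (hf : ContMDiffOn (𝓘(ℝ, ℝ).prod 𝓘(ℝ, ℂ)) 𝓘(ℝ, ℂ) ∞ f (Icc 0 ε ×ˢ V)) :
    ∃ G : ℝ × X → ℂ, ContinuousOn G (Icc 0 ε ×ˢ V) ∧ ∀ t ∈ Icc 0 ε, ∀ x ∈ V,
      HasDerivWithinAt (fun s ↦ f (s, x)) (G (t, x)) (Icc 0 ε) t := by
  set χ := chartAt ℂ p with hχ
  let Z : Set ℂ := χ.target ∩ χ.symm ⁻¹' V
  have hZ : IsOpen Z := χ.isOpen_inter_preimage_symm hV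
  let F : ℝ × ℂ → ℂ := fun q ↦ f (q.1, χ.symm q.2)
  have hsymm : ContMDiffOn 𝓘(ℝ, ℂ) 𝓘(ℝ, ℂ) ∞ χ.symm χ.target := contMDiffOn_chart_symm
  have hF : ContMDiffOn (𝓘(ℝ, ℝ).prod 𝓘(ℝ, ℂ)) 𝓘(ℝ, ℂ) ∞ F (Icc 0 ε ×ˢ Z) := by
    refine hf.comp (g := f) (f := fun q : ℝ × ℂ ↦ (q.1, χ.symm q.2)) ?_ ?_
    · exact contMDiffOn_fst.prodMk (hsymm.comp contMDiffOn_snd fun q hq ↦ hq.2.1)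
    · exact fun q hq ↦ ⟨hq.1, hq.2.2⟩
  have hF' : ContDiffOn ℝ ∞ F (Icc 0 ε ×ˢ Z) := by
    rw [← contMDiffOn_iff_contDiffOn, modelWithCornersSelf_prod, ← chartedSpaceSelf_prod]
    exact hF
  have hu : UniqueDiffOn ℝ (Icc 0 ε ×ˢ Z) := (uniqueDiffOn_Icc hε).prod hZ.uniqueDiffOn
  have hD := hF'.continuousOn_fderivWithin hu (by simp)
  have hmaps : MapsTo (fun q : ℝ × X ↦ (q.1, χ q.2)) (Icc 0 ε ×ˢ V) (Icc 0 ε ×ˢ Z) := by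
    rintro q ⟨h1, h2⟩
    refine ⟨h1, χ.map_source (hVp h2), ?_⟩
    rw [mem_preimage, χ.left_inv (hVp h2)]
    exact h2
  refine ⟨fun q ↦ fderivWithin ℝ F (Icc 0 ε ×ˢ Z) (q.1, χ q.2) (1, 0), ?_, ?_⟩
  · refine ContinuousOn.clm_apply (hD.comp ?_ hmaps) continuousOn_const
    exact continuousOn_fst.prodMk (χ.continuousOn.comp continuousOn_snd fun q hq ↦ hVp hq.2)
  · intro t ht x hx
    have h1 := (hF'.differentiableOn (by simp) _ (hmaps (x := (t, x)) ⟨ht, hx⟩)).hasFDerivWithinAt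
    have h2 : HasDerivWithinAt (fun s : ℝ ↦ (s, χ x)) ((1 : ℝ), (0 : ℂ)) (Icc 0 ε) t :=
      (hasDerivWithinAt_id t _).prodMk (hasDerivWithinAt_const t _ _)
    have h3 := h1.comp_hasDerivWithinAt t h2 (fun s hs ↦ hmaps (x := (s, x)) ⟨hs, hx⟩)
    refine h3.congr (fun s _ ↦ ?_) ?_ <;>
    · simp only [Function.comp_apply, F]
      rw [χ.left_inv (hVp hx)]

variable {L : X → Type*} [TopologicalSpace (TotalSpace ℂ L)]
  [∀ x, NormedAddCommGroup (L x)] [∀ x, InnerProductSpace ℂ (L x)]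
  [FiberBundle ℂ L] [VectorBundle ℝ ℂ L] [ContMDiffVectorBundle ∞ ℂ L 𝓘(ℝ, ℂ)]

/-- In a trivialization of `L` a smooth family of sections has a continuous time derivative. -/
lemma exists_local_deriv {ε : ℝ} (hε : 0 < ε) {U : Set X} (hU : IsOpen U)
    {α : ℝ → ∀ x, L x}
    (hα : ContMDiffOn (𝓘(ℝ, ℝ).prod 𝓘(ℝ, ℂ)) (𝓘(ℝ, ℂ).prod 𝓘(ℝ, ℂ)) ∞
      (fun q : ℝ × X ↦ (⟨q.2, α q.1 q.2⟩ : TotalSpace ℂ L)) (Icc 0 ε ×ˢ U)) {p : X} (hp : p ∈ U) :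
    ∃ V : Set X, IsOpen V ∧ p ∈ V ∧ V ⊆ U ∧ V ⊆ (trivializationAt ℂ L p).baseSet ∧
      ∃ G : ℝ × X → ℂ, ContinuousOn G (Icc 0 ε ×ˢ V) ∧ ∀ t ∈ Icc 0 ε, ∀ x ∈ V,
        HasDerivWithinAt (fun s ↦ α s x) ((trivializationAt ℂ L p).symm x (G (t, x)))
          (Icc 0 ε) t := by
  set e := trivializationAt ℂ L p with he
  let V : Set X := U ∩ (e.baseSet ∩ (chartAt ℂ p).source)
  have hV : IsOpen V := hU.inter (e.open_baseSet.inter (chartAt ℂ p).open_source)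
  have hVe : V ⊆ e.baseSet := fun x hx ↦ hx.2.1
  have h1 := hα.mono (prod_mono_right (s := Icc 0 ε) (inter_subset_left : V ⊆ U))
  rw [e.contMDiffOn_iff (fun q hq ↦ by rw [e.mem_source]; exact hVe hq.2)] at h1
  obtain ⟨G, hG, hGd⟩ := exists_partial_deriv hε hV (p := p) (fun x hx ↦ hx.2.2) h1.2
  refine ⟨V, hV, ⟨hp, FiberBundle.mem_baseSet_trivializationAt' p, mem_chart_source ℂ p⟩,
    inter_subset_left, hVe, G, hG, fun t ht x hx ↦ ?_⟩
  have hxe := hVe hx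
  have h2 := ((e.continuousLinearEquivAt ℝ x hxe).symm : ℂ →L[ℝ] L x).hasFDerivAt
    |>.comp_hasDerivWithinAt t (hGd t ht x hx)
  refine h2.congr (fun s _ ↦ ?_) ?_ <;>
  · exact ((e.continuousLinearEquivAt ℝ x hxe).symm_apply_apply _).symm

/-- Smooth families of sections are differentiable in time. -/
lemma hasDerivWithinAt_of_contMDiffOn {ε : ℝ} (hε : 0 < ε) {U : Set X} (hU : IsOpen U)
    {α : ℝ → ∀ x, L x}
    (hα : ContMDiffOn (𝓘(ℝ, ℝ).prod 𝓘(ℝ, ℂ)) (𝓘(ℝ, ℂ).prod 𝓘(ℝ, ℂ)) ∞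
      (fun q : ℝ × X ↦ (⟨q.2, α q.1 q.2⟩ : TotalSpace ℂ L)) (Icc 0 ε ×ˢ U))
    {t : ℝ} (ht : t ∈ Icc 0 ε) {x : X} (hx : x ∈ U) :
    HasDerivWithinAt (fun s ↦ α s x) (derivWithin (fun s ↦ α s x) (Icc 0 ε) t) (Icc 0 ε) t := by
  obtain ⟨V, -, hxV, -, -, G, -, hd⟩ := exists_local_deriv hε hU hα hx
  exact (hd t ht x hxV).differentiableWithinAt.hasDerivWithinAt

/-- The time derivative of a smooth family of sections is a continuous family of sections. -/
lemma continuousOn_derivWithin_section {ε : ℝ} (hε : 0 < ε) {U : Set X} (hU : IsOpen U)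
    {α : ℝ → ∀ x, L x}
    (hα : ContMDiffOn (𝓘(ℝ, ℝ).prod 𝓘(ℝ, ℂ)) (𝓘(ℝ, ℂ).prod 𝓘(ℝ, ℂ)) ∞
      (fun q : ℝ × X ↦ (⟨q.2, α q.1 q.2⟩ : TotalSpace ℂ L)) (Icc 0 ε ×ˢ U)) :
    ContinuousOn (fun q : ℝ × X ↦
      (⟨q.2, derivWithin (fun s ↦ α s q.2) (Icc 0 ε) q.1⟩ : TotalSpace ℂ L)) (Icc 0 ε ×ˢ U) := by
  rintro ⟨t₀, p⟩ ⟨ht₀, hp⟩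
  obtain ⟨V, hV, hpV, hVU, hVe, G, hG, hd⟩ := exists_local_deriv hε hU hα hp
  have hnhds : Icc 0 ε ×ˢ V ∈ 𝓝[Icc 0 ε ×ˢ U] (t₀, p) := by
    rw [nhdsWithin_prod_eq]
    exact prod_mem_prod self_mem_nhdsWithin (mem_nhdsWithin_of_mem_nhds (hV.mem_nhds hpV))
  rw [FiberBundle.continuousWithinAt_totalSpace]
  refine ⟨continuousWithinAt_snd, ?_⟩
  refine ContinuousWithinAt.mono_of_mem_nhdsWithin ?_ hnhds
  refine (hG (t₀, p) ⟨ht₀, hpV⟩).congr_of_mem (fun q hq ↦ ?_) ⟨ht₀, hpV⟩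
  rw [(hd q.1 hq.1 q.2 hq.2).derivWithin (uniqueDiffOn_Icc hε q.1 hq.1)]
  rw [Trivialization.apply_mk_symm _ (hVe hq.2)]

end TimeDerivative

/-! ### Integral identities on the product of an interval and a compact space -/

section Poincare

variable {E : Type*} [NormedAddCommGroup E] [InnerProductSpace ℂ E]

/-- The Cauchy-Schwarz inequality `‖f t‖² ≤ t ∫₀ᵗ ‖f'‖²` for a function vanishing at `0`. -/
lemma norm_sq_le_mul_integral {f f' : ℝ → E} {t : ℝ} (ht : 0 < t)
    (hf : ∀ s ∈ Icc 0 t, HasDerivWithinAt f (f' s) (Icc 0 t) s)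
    (hf' : ContinuousOn f' (Icc 0 t)) (h0 : f 0 = 0) :
    ‖f t‖ ^ 2 ≤ t * ∫ s in (0 : ℝ)..t, ‖f' s‖ ^ 2 := by
  have huIcc : uIcc 0 t = Icc 0 t := uIcc_of_le ht.le
  have hc1 : ContinuousOn (fun s ↦ (inner ℂ (f t) (f' s)).re) (Icc 0 t) :=
    Complex.continuous_re.comp_continuousOn (continuousOn_const.inner (𝕜 := ℂ) hf')
  have hc2 : ContinuousOn (fun s ↦ ‖f' s‖ ^ 2) (Icc 0 t) := hf'.norm.pow 2
  have hder : ∀ s ∈ Icc 0 t, HasDerivWithinAt (fun s ↦ (inner ℂ (f t) (f s)).re)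
      ((inner ℂ (f t) (f' s)).re) (Icc 0 t) s := fun s hs ↦
    ((Complex.reCLM.comp ((innerSL ℂ (f t)).restrictScalars ℝ)).hasFDerivAt).comp_hasDerivWithinAt
      s (hf s hs)
  have hFTC : ∫ s in (0 : ℝ)..t, (inner ℂ (f t) (f' s)).re = ‖f t‖ ^ 2 := by
    rw [intervalIntegral.integral_eq_sub_of_hasDerivAt_of_le ht.le
      (fun s hs ↦ (hder s hs).continuousWithinAt)
      (fun s hs ↦ (hder s (Ioo_subset_Icc_self hs)).hasDerivAt (Icc_mem_nhds hs.1 hs.2))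
      (hc1.intervalIntegrable_of_Icc ht.le), h0, inner_zero_right]
    rw [← inner_self_eq_norm_sq (𝕜 := ℂ)]
    simp
  have hi1 := hc1.intervalIntegrable_of_Icc ht.le (μ := volume)
  have hi2 := hc2.intervalIntegrable_of_Icc ht.le (μ := volume)
  have hexp : ∀ s, ‖(t : ℂ) • f' s - f t‖ ^ 2
      = t ^ 2 * ‖f' s‖ ^ 2 - 2 * t * (inner ℂ (f t) (f' s)).re + ‖f t‖ ^ 2 := by
    intro s
    rw [← norm_sub_rev, norm_sub_sq (𝕜 := ℂ), inner_smul_right, norm_smul, mul_pow]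
    simp
    ring
  -- Integrating `0 ≤ ‖t f' - f t‖²` yields `0 ≤ t (t ∫ ‖f'‖² - ‖f t‖²)`.
  have hpos : 0 ≤ ∫ s in (0 : ℝ)..t, ‖(t : ℂ) • f' s - f t‖ ^ 2 :=
    intervalIntegral.integral_nonneg ht.le fun s _ ↦ by positivity
  simp_rw [hexp] at hpos
  rw [intervalIntegral.integral_add ((hi2.const_mul _).sub (hi1.const_mul _)) (by simp),
    intervalIntegral.integral_sub (hi2.const_mul _) (hi1.const_mul _),
    intervalIntegral.integral_const_mul, intervalIntegral.integral_const_mul, hFTC,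
    intervalIntegral.integral_const, sub_zero, smul_eq_mul] at hpos
  have h2 : 0 ≤ t * (t * (∫ s in (0 : ℝ)..t, ‖f' s‖ ^ 2) - ‖f t‖ ^ 2) := by linarith
  exact sub_nonneg.1 (nonneg_of_mul_nonneg_right h2 ht)

/-- The Poincaré inequality with constant `2 / ε²` for functions on `[0, ε]` which vanish at `0`. -/
lemma poincare_inequality {f f' : ℝ → E} {ε : ℝ} (hε : 0 < ε)
    (hf : ∀ s ∈ Icc 0 ε, HasDerivWithinAt f (f' s) (Icc 0 ε) s)
    (hf' : ContinuousOn f' (Icc 0 ε)) (h0 : f 0 = 0) :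
    ENNReal.ofReal (2 / ε ^ 2) * ∫⁻ s in Icc 0 ε, ENNReal.ofReal (‖f s‖ ^ 2)
      ≤ ∫⁻ s in Icc 0 ε, ENNReal.ofReal (‖f' s‖ ^ 2) := by
  have hfc : ContinuousOn f (Icc 0 ε) := fun s hs ↦ (hf s hs).continuousWithinAt
  have hc : ContinuousOn (fun s ↦ ‖f s‖ ^ 2) (Icc 0 ε) := hfc.norm.pow 2
  have hc' : ContinuousOn (fun s ↦ ‖f' s‖ ^ 2) (Icc 0 ε) := hf'.norm.pow 2
  set J := ∫ s in (0 : ℝ)..ε, ‖f' s‖ ^ 2 with hJ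
  have hJ0 : 0 ≤ J := intervalIntegral.integral_nonneg hε.le fun s _ ↦ by positivity
  have hpt : ∀ t ∈ Icc 0 ε, ‖f t‖ ^ 2 ≤ t * J := by
    intro t ht
    rcases ht.1.eq_or_lt with rfl | htp
    · simp [h0]
    have hsub : Icc 0 t ⊆ Icc 0 ε := Icc_subset_Icc_right ht.2
    refine (norm_sq_le_mul_integral htp (fun s hs ↦ (hf s (hsub hs)).mono hsub)
      (hf'.mono hsub) h0).trans (mul_le_mul_of_nonneg_left ?_ htp.le)
    exact intervalIntegral.integral_mono_interval le_rfl htp.le ht.2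
      (ae_of_all _ fun s ↦ by positivity) (hc'.intervalIntegrable_of_Icc hε.le)
  have hint : ∫ s in (0 : ℝ)..ε, ‖f s‖ ^ 2 ≤ ε ^ 2 / 2 * J := by
    refine (intervalIntegral.integral_mono_on hε.le (hc.intervalIntegrable_of_Icc hε.le)
      (Continuous.intervalIntegrable (by fun_prop) _ _) hpt).trans (le_of_eq ?_)
    rw [intervalIntegral.integral_mul_const, integral_id]
    ring
  have hconv : ∀ {φ : ℝ → ℝ}, ContinuousOn φ (Icc 0 ε) → (∀ s, 0 ≤ φ s) →
      ∫⁻ s in Icc 0 ε, ENNReal.ofReal (φ s) = ENNReal.ofReal (∫ s in (0 : ℝ)..ε, φ s) := by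
    intro φ hφ hφ0
    rw [intervalIntegral.integral_of_le hε.le, ← integral_Icc_eq_integral_Ioc,
      ofReal_integral_eq_lintegral_ofReal (hφ.integrableOn_Icc) (ae_of_all _ hφ0)]
  rw [hconv hc fun s ↦ by positivity, hconv hc' fun s ↦ by positivity,
    ← ENNReal.ofReal_mul (by positivity)]
  refine ENNReal.ofReal_le_ofReal ?_
  calc 2 / ε ^ 2 * ∫ s in (0 : ℝ)..ε, ‖f s‖ ^ 2 ≤ 2 / ε ^ 2 * (ε ^ 2 / 2 * J) :=
        mul_le_mul_of_nonneg_left hint (by positivity)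
    _ = J := by field_simp

end Poincare

section Pairing

variable {X : Type*} [MeasurableSpace X] {μ : Measure X} [IsFiniteMeasure μ]
  {E : X → Type*} [∀ x, NormedAddCommGroup (E x)] [∀ x, InnerProductSpace ℂ (E x)]

/-- If `⟨b s, v t⟩ = ⟨u s, w t⟩` in `L²` for all times `s`, `t`, then the time derivative of
`⟨u t, w t⟩ = ⟨b t, v t⟩` is `⟨u' t, w t⟩ + ⟨b t, v' t⟩`: the first factor is differentiated in
the first expression and the second factor in the second one, so that no derivatives of `b` and
`w` occur. -/
lemma integral_pairing_deriv {ε : ℝ} (hε : 0 < ε) {u u' w b v v' : ℝ → ∀ x, E x} {C : ℝ}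
    (hu : ∀ x, ∀ t ∈ Icc 0 ε, HasDerivWithinAt (fun s ↦ u s x) (u' t x) (Icc 0 ε) t)
    (hv : ∀ x, ∀ t ∈ Icc 0 ε, HasDerivWithinAt (fun s ↦ v s x) (v' t x) (Icc 0 ε) t)
    (hw : ∀ x, ContinuousOn (fun t ↦ w t x) (Icc 0 ε))
    (bu : ∀ t ∈ Icc 0 ε, ∀ x, ‖u t x‖ ≤ C) (bu' : ∀ t ∈ Icc 0 ε, ∀ x, ‖u' t x‖ ≤ C)
    (bw : ∀ t ∈ Icc 0 ε, ∀ x, ‖w t x‖ ≤ C) (bb : ∀ t ∈ Icc 0 ε, ∀ x, ‖b t x‖ ≤ C)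
    (bv : ∀ t ∈ Icc 0 ε, ∀ x, ‖v t x‖ ≤ C) (bv' : ∀ t ∈ Icc 0 ε, ∀ x, ‖v' t x‖ ≤ C)
    (muw : ∀ s ∈ Icc 0 ε, ∀ t ∈ Icc 0 ε,
      AEStronglyMeasurable (fun x ↦ inner ℂ (u s x) (w t x)) μ)
    (mbv : ∀ s ∈ Icc 0 ε, ∀ t ∈ Icc 0 ε,
      AEStronglyMeasurable (fun x ↦ inner ℂ (b s x) (v t x)) μ)
    (hadj : ∀ s ∈ Icc 0 ε, ∀ t ∈ Icc 0 ε,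
      ∫ x, inner ℂ (b s x) (v t x) ∂μ = ∫ x, inner ℂ (u s x) (w t x) ∂μ)
    (hint : IntervalIntegrable
      (fun t ↦ ∫ x, (inner ℂ (u' t x) (w t x) + inner ℂ (b t x) (v' t x)) ∂μ) volume 0 ε) :
    ∫ t in (0 : ℝ)..ε, ∫ x, (inner ℂ (u' t x) (w t x) + inner ℂ (b t x) (v' t x)) ∂μ
      = ∫ x, inner ℂ (u ε x) (w ε x) ∂μ - ∫ x, inner ℂ (u 0 x) (w 0 x) ∂μ := by
  have bmul : ∀ {x : X} {y z : E x} {A B : ℝ}, ‖y‖ ≤ A → ‖z‖ ≤ B → ‖inner ℂ y z‖ ≤ A * B :=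
    fun hy hz ↦ (norm_inner_le_norm _ _).trans
      (mul_le_mul hy hz (norm_nonneg _) ((norm_nonneg _).trans hy))
  have iuw : ∀ s ∈ Icc 0 ε, ∀ t ∈ Icc 0 ε, Integrable (fun x ↦ inner ℂ (u s x) (w t x)) μ :=
    fun s hs t ht ↦ Integrable.of_bound (muw s hs t ht) (C * C)
      (ae_of_all _ fun x ↦ bmul (bu s hs x) (bw t ht x))
  have ibv : ∀ s ∈ Icc 0 ε, ∀ t ∈ Icc 0 ε, Integrable (fun x ↦ inner ℂ (b s x) (v t x)) μ :=
    fun s hs t ht ↦ Integrable.of_bound (mbv s hs t ht) (C * C)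
      (ae_of_all _ fun x ↦ bmul (bb s hs x) (bv t ht x))
  have hcont : ContinuousOn (fun t ↦ ∫ x, inner ℂ (u t x) (w t x) ∂μ) (Icc 0 ε) := by
    refine continuousOn_of_dominated (bound := fun _ ↦ C * C) (fun t ht ↦ muw t ht t ht)
      (fun t ht ↦ ae_of_all _ fun x ↦ bmul (bu t ht x) (bw t ht x)) (integrable_const _)
      (ae_of_all _ fun x ↦ ?_)
    exact ContinuousOn.inner (𝕜 := ℂ) (fun t ht ↦ (hu x t ht).continuousWithinAt) (hw x)
  refine intervalIntegral.integral_eq_sub_of_hasDerivAt_of_le hε.le hcont (fun t ht ↦ ?_) hint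
  have htI := Ioo_subset_Icc_self ht
  have hnhds : Icc 0 ε ∈ 𝓝 t := Icc_mem_nhds ht.1 ht.2
  have hev : ∀ᶠ s in 𝓝[≠] t, s ∈ Icc 0 ε := mem_nhdsWithin_of_mem_nhds hnhds
  rw [hasDerivAt_iff_tendsto_slope]
  have hexp : ∀ s x, inner ℂ (slope (fun r ↦ u r x) t s) (w s x)
      + inner ℂ (b t x) (slope (fun r ↦ v r x) t s)
      = (s - t)⁻¹ • ((inner ℂ (u s x) (w s x) - inner ℂ (u t x) (w s x))
        + (inner ℂ (b t x) (v s x) - inner ℂ (b t x) (v t x))) := by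
    intro s x
    simp only [slope_def_module]
    rw [← Complex.coe_smul, ← Complex.coe_smul, inner_smul_left, inner_smul_right,
      inner_sub_left, inner_sub_right, Complex.conj_ofReal, ← mul_add, Complex.real_smul]
  -- The adjointness at the two different times `t` and `s` replaces `⟨u t, w s⟩` by `⟨b t, v s⟩`.
  have hsl : ∀ s ∈ Icc 0 ε, slope (fun t ↦ ∫ x, inner ℂ (u t x) (w t x) ∂μ) t s
      = ∫ x, (inner ℂ (slope (fun r ↦ u r x) t s) (w s x)
        + inner ℂ (b t x) (slope (fun r ↦ v r x) t s)) ∂μ := by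
    intro s hs
    simp_rw [hexp s]
    have hA : Integrable (fun x ↦ inner ℂ (u s x) (w s x) - inner ℂ (u t x) (w s x)) μ :=
      (iuw s hs s hs).sub (iuw t htI s hs)
    have hB : Integrable (fun x ↦ inner ℂ (b t x) (v s x) - inner ℂ (b t x) (v t x)) μ :=
      (ibv t htI s hs).sub (ibv t htI t htI)
    rw [integral_smul, integral_add hA hB, integral_sub (iuw s hs s hs) (iuw t htI s hs),
      integral_sub (ibv t htI s hs) (ibv t htI t htI), hadj t htI s hs, hadj t htI t htI,
      slope_def_module]
    congr 1
    ring
  have hslb : ∀ {f f' : ℝ → ∀ x, E x},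
      (∀ x, ∀ t ∈ Icc 0 ε, HasDerivWithinAt (fun s ↦ f s x) (f' t x) (Icc 0 ε) t) →
      (∀ t ∈ Icc 0 ε, ∀ x, ‖f' t x‖ ≤ C) → ∀ s ∈ Icc 0 ε, ∀ x,
      s ≠ t → ‖slope (fun r ↦ f r x) t s‖ ≤ C := by
    intro f f' hf hb s hs x hst
    have h1 := (convex_Icc (0 : ℝ) ε).norm_image_sub_le_of_norm_hasDerivWithin_le
      (fun r hr ↦ hf x r hr) (fun r hr ↦ hb r hr x) htI hs
    rw [slope_def_module, norm_smul, norm_inv]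
    rw [inv_mul_le_iff₀ (norm_pos_iff.2 (sub_ne_zero.2 hst)), mul_comm]
    exact h1
  have key : Tendsto (fun s ↦ ∫ x, (inner ℂ (slope (fun r ↦ u r x) t s) (w s x)
        + inner ℂ (b t x) (slope (fun r ↦ v r x) t s)) ∂μ) (𝓝[≠] t)
      (𝓝 (∫ x, (inner ℂ (u' t x) (w t x) + inner ℂ (b t x) (v' t x)) ∂μ)) := by
    refine tendsto_integral_filter_of_dominated_convergence (fun _ ↦ C * C + C * C) ?_ ?_
      (integrable_const _) (ae_of_all _ fun x ↦ ?_)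
    · filter_upwards [hev] with s hs
      simp_rw [hexp s]
      have hm := ((muw s hs s hs).sub (muw t htI s hs)).add
        ((mbv t htI s hs).sub (mbv t htI t htI))
      exact hm.const_smul (s - t)⁻¹
    · filter_upwards [hev, self_mem_nhdsWithin] with s hs hst
      refine ae_of_all _ fun x ↦ (norm_add_le _ _).trans (add_le_add ?_ ?_)
      · exact bmul (hslb hu bu' s hs x hst) (bw s hs x)
      · exact bmul (bb t htI x) (hslb hv bv' s hs x hst)
    · have h1 : Tendsto (fun s ↦ slope (fun r ↦ u r x) t s) (𝓝[≠] t) (𝓝 (u' t x)) :=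
        hasDerivAt_iff_tendsto_slope.1 ((hu x t htI).hasDerivAt hnhds)
      have h2 : Tendsto (fun s ↦ slope (fun r ↦ v r x) t s) (𝓝[≠] t) (𝓝 (v' t x)) :=
        hasDerivAt_iff_tendsto_slope.1 ((hv x t htI).hasDerivAt hnhds)
      have h3 : Tendsto (fun s ↦ w s x) (𝓝[≠] t) (𝓝 (w t x)) :=
        ((hw x).continuousAt hnhds).tendsto.mono_left nhdsWithin_le_nhds
      exact (h1.inner h3).add (tendsto_const_nhds.inner h2)
  refine key.congr' ?_
  filter_upwards [hev] with s hs using (hsl s hs).symm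

end Pairing

/-! ### Energy estimates on the product -/

section Product

variable {X : Type*} [TopologicalSpace X] [CompactSpace X] [SecondCountableTopology X]
  [MeasurableSpace X] [BorelSpace X] {μ : Measure X} [IsFiniteMeasure μ] {ε : ℝ}

lemma restrict_Icc_prod (ε : ℝ) (μ : Measure X) [IsFiniteMeasure μ] :
    (volume.restrict (Icc 0 ε)).prod μ
      = ((volume : Measure ℝ).prod μ).restrict (Icc 0 ε ×ˢ univ) := by
  rw [← Measure.prod_restrict, Measure.restrict_univ]

lemma aestronglyMeasurable_of_continuousOn_prod {F : Type*} [NormedAddCommGroup F]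
    [SecondCountableTopology F] {f : ℝ × X → F}
    (hf : ContinuousOn f (Icc 0 ε ×ˢ univ)) :
    AEStronglyMeasurable f ((volume.restrict (Icc 0 ε)).prod μ) := by
  rw [restrict_Icc_prod]
  exact hf.aestronglyMeasurable (measurableSet_Icc.prod MeasurableSet.univ)

lemma integrable_of_continuousOn_prod {F : Type*} [NormedAddCommGroup F]
    [SecondCountableTopology F] {f : ℝ × X → F} (hf : ContinuousOn f (Icc 0 ε ×ˢ univ)) :
    Integrable f ((volume.restrict (Icc 0 ε)).prod μ) := by
  obtain ⟨C, hC⟩ := (isCompact_Icc.prod isCompact_univ).exists_bound_of_continuousOn hf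
  refine Integrable.of_bound (aestronglyMeasurable_of_continuousOn_prod hf) C ?_
  rw [restrict_Icc_prod]
  exact (ae_restrict_mem (measurableSet_Icc.prod MeasurableSet.univ)).mono fun q hq ↦ hC q hq

lemma aemeasurable_ofReal_of_continuousOn_prod {f : ℝ × X → ℝ}
    (hf : ContinuousOn f (Icc 0 ε ×ˢ univ)) :
    AEMeasurable (fun q ↦ ENNReal.ofReal (f q)) ((volume.restrict (Icc 0 ε)).prod μ) :=
  (aestronglyMeasurable_of_continuousOn_prod hf).aemeasurable.ennreal_ofReal

lemma continuous_slice {F : Type*} [TopologicalSpace F] {f : ℝ × X → F}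
    (hf : ContinuousOn f (Icc 0 ε ×ˢ univ)) {t : ℝ} (ht : t ∈ Icc 0 ε) :
    Continuous (fun x ↦ f (t, x)) :=
  hf.comp_continuous (by fun_prop) fun x ↦ ⟨ht, mem_univ x⟩

lemma lintegral_ofReal_eq_of_continuousOn_prod {f : ℝ × X → ℝ}
    (hf : ContinuousOn f (Icc 0 ε ×ˢ univ)) (hpos : ∀ q ∈ Icc 0 ε ×ˢ univ, 0 ≤ f q) :
    ∫⁻ t in Icc 0 ε, ∫⁻ x, ENNReal.ofReal (f (t, x)) ∂μ
      = ENNReal.ofReal (∫ t in Icc 0 ε, ∫ x, f (t, x) ∂μ) := by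
  have hi := integrable_of_continuousOn_prod (μ := μ) hf
  rw [← lintegral_prod _ (aemeasurable_ofReal_of_continuousOn_prod hf), ← integral_prod _ hi,
    ofReal_integral_eq_lintegral_ofReal hi]
  rw [restrict_Icc_prod]
  exact (ae_restrict_mem (measurableSet_Icc.prod MeasurableSet.univ)).mono hpos

lemma lintegral_ofReal_lt_top_of_continuousOn_prod {f : ℝ × X → ℝ}
    (hf : ContinuousOn f (Icc 0 ε ×ˢ univ)) (hpos : ∀ q ∈ Icc 0 ε ×ˢ univ, 0 ≤ f q) :
    ∫⁻ t in Icc 0 ε, ∫⁻ x, ENNReal.ofReal (f (t, x)) ∂μ < ⊤ := by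
  rw [lintegral_ofReal_eq_of_continuousOn_prod hf hpos]
  exact ENNReal.ofReal_lt_top

/-- Lower bound for an energy `e ≥ K^{-1/2} (B + D)`, when `B` controls `A` on the slices
`{t} × X` and `D` controls `C` on the intervals `[0, ε] × {x}`. -/
lemma energy_lower_bound {A B C D e : ℝ × X → ℝ} {ρ : X → ℝ} {K : ℝ} (hK : 0 < K) {m : ℝ≥0∞}
    (hA : ContinuousOn A (Icc 0 ε ×ˢ univ)) (hB : ContinuousOn B (Icc 0 ε ×ˢ univ))
    (hC : ContinuousOn C (Icc 0 ε ×ˢ univ)) (hD : ContinuousOn D (Icc 0 ε ×ˢ univ))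
    (A0 : ∀ q, 0 ≤ A q) (B0 : ∀ q, 0 ≤ B q) (C0 : ∀ q, 0 ≤ C q) (D0 : ∀ q, 0 ≤ D q)
    (hslice : ∀ t ∈ Icc 0 ε, m * ∫⁻ x, ENNReal.ofReal (A (t, x)) ∂μ
      ≤ ∫⁻ x, ENNReal.ofReal (B (t, x)) ∂μ)
    (hline : ∀ x, m * ∫⁻ t in Icc 0 ε, ENNReal.ofReal (C (t, x))
      ≤ ∫⁻ t in Icc 0 ε, ENNReal.ofReal (D (t, x)))
    (hρ : ∀ x, ρ x ≤ Real.sqrt K)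
    (he : ∀ q ∈ Icc 0 ε ×ˢ univ, (Real.sqrt K)⁻¹ * (B q + D q) ≤ e q) :
    ENNReal.ofReal (1 / K) * m *
        ∫⁻ t in Icc 0 ε, ∫⁻ x, ENNReal.ofReal ((A (t, x) + C (t, x)) * ρ x) ∂μ
      ≤ ∫⁻ t in Icc 0 ε, ∫⁻ x, ENNReal.ofReal (e (t, x)) ∂μ := by
  have hsK : 0 < Real.sqrt K := Real.sqrt_pos.2 hK
  have split : ∀ {F G : ℝ × X → ℝ}, ContinuousOn F (Icc 0 ε ×ˢ univ) → (∀ q, 0 ≤ F q) →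
      (∀ q, 0 ≤ G q) → ContinuousOn G (Icc 0 ε ×ˢ univ) → ∀ {k : ℝ}, 0 ≤ k →
      ∫⁻ t in Icc 0 ε, ∫⁻ x, ENNReal.ofReal (k * (F (t, x) + G (t, x))) ∂μ
      = ENNReal.ofReal k * ((∫⁻ t in Icc 0 ε, ∫⁻ x, ENNReal.ofReal (F (t, x)) ∂μ)
        + ∫⁻ t in Icc 0 ε, ∫⁻ x, ENNReal.ofReal (G (t, x)) ∂μ) := by
    intro F G hF F0 G0 hG k hk
    have mF := aemeasurable_ofReal_of_continuousOn_prod (μ := μ) hF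
    have mG := aemeasurable_ofReal_of_continuousOn_prod (μ := μ) hG
    have mFG : AEMeasurable (fun q ↦ ENNReal.ofReal (k * (F q + G q)))
        ((volume.restrict (Icc 0 ε)).prod μ) :=
      aemeasurable_ofReal_of_continuousOn_prod (μ := μ) (continuousOn_const.mul (hF.add hG))
    rw [← lintegral_prod _ mFG, ← lintegral_prod _ mF, ← lintegral_prod _ mG,
      ← lintegral_add_left' mF, ← lintegral_const_mul' _ _ ENNReal.ofReal_ne_top]
    refine lintegral_congr fun q ↦ ?_
    rw [ENNReal.ofReal_mul hk, ENNReal.ofReal_add (F0 q) (G0 q)]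
  have h1 : ∫⁻ t in Icc 0 ε, ∫⁻ x, ENNReal.ofReal ((A (t, x) + C (t, x)) * ρ x) ∂μ
      ≤ ENNReal.ofReal (Real.sqrt K) * ((∫⁻ t in Icc 0 ε, ∫⁻ x, ENNReal.ofReal (A (t, x)) ∂μ)
        + ∫⁻ t in Icc 0 ε, ∫⁻ x, ENNReal.ofReal (C (t, x)) ∂μ) := by
    rw [← split hA A0 C0 hC hsK.le]
    refine lintegral_mono fun t ↦ lintegral_mono fun x ↦ ENNReal.ofReal_le_ofReal ?_
    rw [mul_comm]
    exact mul_le_mul_of_nonneg_right (hρ x) (add_nonneg (A0 _) (C0 _))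
  have h2 : m * ∫⁻ t in Icc 0 ε, ∫⁻ x, ENNReal.ofReal (A (t, x)) ∂μ
      ≤ ∫⁻ t in Icc 0 ε, ∫⁻ x, ENNReal.ofReal (B (t, x)) ∂μ := by
    rw [← lintegral_const_mul'' _
      (aemeasurable_ofReal_of_continuousOn_prod hA).lintegral_prod_right']
    exact setLIntegral_mono' measurableSet_Icc hslice
  have h3 : m * ∫⁻ t in Icc 0 ε, ∫⁻ x, ENNReal.ofReal (C (t, x)) ∂μ
      ≤ ∫⁻ t in Icc 0 ε, ∫⁻ x, ENNReal.ofReal (D (t, x)) ∂μ := by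
    have mC := aemeasurable_ofReal_of_continuousOn_prod (μ := μ) hC
    have mD := aemeasurable_ofReal_of_continuousOn_prod (μ := μ) hD
    rw [lintegral_lintegral_swap (f := fun t x ↦ ENNReal.ofReal (C (t, x))) mC,
      lintegral_lintegral_swap (f := fun t x ↦ ENNReal.ofReal (D (t, x))) mD,
      ← lintegral_const_mul'' (f := fun x ↦ ∫⁻ t in Icc 0 ε, ENNReal.ofReal (C (t, x))) _
        mC.prod_swap.lintegral_prod_right']
    exact lintegral_mono hline
  have h4 : ENNReal.ofReal ((Real.sqrt K)⁻¹) *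
      ((∫⁻ t in Icc 0 ε, ∫⁻ x, ENNReal.ofReal (B (t, x)) ∂μ)
        + ∫⁻ t in Icc 0 ε, ∫⁻ x, ENNReal.ofReal (D (t, x)) ∂μ)
      ≤ ∫⁻ t in Icc 0 ε, ∫⁻ x, ENNReal.ofReal (e (t, x)) ∂μ := by
    rw [← split hB B0 D0 hD (inv_nonneg.2 hsK.le)]
    refine setLIntegral_mono' measurableSet_Icc fun t ht ↦ lintegral_mono fun x ↦
      ENNReal.ofReal_le_ofReal (he (t, x) ⟨ht, mem_univ x⟩)
  have hk : ENNReal.ofReal (1 / K) * ENNReal.ofReal (Real.sqrt K)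
      = ENNReal.ofReal ((Real.sqrt K)⁻¹) := by
    rw [← ENNReal.ofReal_mul (by positivity)]
    congr 1
    have := Real.mul_self_sqrt hK.le
    field_simp
    rw [sq, this]
  refine le_trans ?_ h4
  calc _ ≤ ENNReal.ofReal (1 / K) * m * (ENNReal.ofReal (Real.sqrt K) *
          ((∫⁻ t in Icc 0 ε, ∫⁻ x, ENNReal.ofReal (A (t, x)) ∂μ)
          + ∫⁻ t in Icc 0 ε, ∫⁻ x, ENNReal.ofReal (C (t, x)) ∂μ)) := by gcongr
    _ = ENNReal.ofReal ((Real.sqrt K)⁻¹) *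
          (m * (∫⁻ t in Icc 0 ε, ∫⁻ x, ENNReal.ofReal (A (t, x)) ∂μ)
          + m * ∫⁻ t in Icc 0 ε, ∫⁻ x, ENNReal.ofReal (C (t, x)) ∂μ) := by
        rw [← hk]
        ring
    _ ≤ _ := by gcongr

variable {E : X → Type*} [∀ x, NormedAddCommGroup (E x)] [∀ x, InnerProductSpace ℂ (E x)]

/-- The square of the norm of `(i ρ⁻¹ u' + w, - i ρ⁻¹ v' + b)`, weighted by `ρ`: the weight cancels
in the mixed terms. -/
lemma norm_sq_dirac_expand {F : Type*} [NormedAddCommGroup F] [InnerProductSpace ℂ F]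
    (u' w v' b : F) {ρ : ℝ} (hρ : 0 < ρ) :
    (‖Complex.I • ρ⁻¹ • u' + w‖ ^ 2 + ‖-(Complex.I • ρ⁻¹ • v') + b‖ ^ 2) * ρ
      = ρ⁻¹ * (‖u'‖ ^ 2 + ‖v'‖ ^ 2) + ρ * (‖w‖ ^ 2 + ‖b‖ ^ 2)
        + 2 * (inner ℂ u' w + inner ℂ b v').im := by
  have h1 : (inner ℂ b v').im = - (inner ℂ v' b).im := by
    rw [← inner_conj_symm b v', Complex.conj_im]
  rw [Complex.add_im, h1, norm_add_sq (𝕜 := ℂ), norm_add_sq (𝕜 := ℂ), inner_neg_left, norm_neg,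
    inner_smul_left, inner_smul_left, ← Complex.coe_smul, ← Complex.coe_smul, inner_smul_left,
    inner_smul_left, norm_smul, norm_smul, norm_smul, norm_smul]
  simp only [Complex.norm_I, Complex.norm_real, Real.norm_eq_abs, mul_pow, sq_abs, one_mul,
    Complex.conj_I, Complex.conj_ofReal, RCLike.re_eq_complex_re]
  simp
  field_simp
  ring

/-- For smooth spinors, whose mixed terms integrate to zero, the energy of the Dirac operator
is the sum of the energies of its parts. -/
lemma lintegral_dirac_eq (hε : 0 < ε) {u u' w b v v' : ℝ → ∀ x, E x} {ρ : X → ℝ}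
    (hρc : Continuous ρ) (hρ : ∀ x, 0 < ρ x)
    (hu : ∀ x, ∀ t ∈ Icc 0 ε, HasDerivWithinAt (fun s ↦ u s x) (u' t x) (Icc 0 ε) t)
    (hv : ∀ x, ∀ t ∈ Icc 0 ε, HasDerivWithinAt (fun s ↦ v s x) (v' t x) (Icc 0 ε) t)
    (hw : ∀ x, ContinuousOn (fun t ↦ w t x) (Icc 0 ε))
    (cu : ContinuousOn (fun q : ℝ × X ↦ ‖u q.1 q.2‖ ^ 2) (Icc 0 ε ×ˢ univ))
    (cu' : ContinuousOn (fun q : ℝ × X ↦ ‖u' q.1 q.2‖ ^ 2) (Icc 0 ε ×ˢ univ))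
    (cw : ContinuousOn (fun q : ℝ × X ↦ ‖w q.1 q.2‖ ^ 2) (Icc 0 ε ×ˢ univ))
    (cb : ContinuousOn (fun q : ℝ × X ↦ ‖b q.1 q.2‖ ^ 2) (Icc 0 ε ×ˢ univ))
    (cv : ContinuousOn (fun q : ℝ × X ↦ ‖v q.1 q.2‖ ^ 2) (Icc 0 ε ×ˢ univ))
    (cv' : ContinuousOn (fun q : ℝ × X ↦ ‖v' q.1 q.2‖ ^ 2) (Icc 0 ε ×ˢ univ))
    (cuw : ContinuousOn (fun q : ℝ × X ↦ inner ℂ (u' q.1 q.2) (w q.1 q.2)) (Icc 0 ε ×ˢ univ))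
    (cbv : ContinuousOn (fun q : ℝ × X ↦ inner ℂ (b q.1 q.2) (v' q.1 q.2)) (Icc 0 ε ×ˢ univ))
    (muw : ∀ s ∈ Icc 0 ε, ∀ t ∈ Icc 0 ε, Continuous (fun x ↦ inner ℂ (u s x) (w t x)))
    (mbv : ∀ s ∈ Icc 0 ε, ∀ t ∈ Icc 0 ε, Continuous (fun x ↦ inner ℂ (b s x) (v t x)))
    (hadj : ∀ s ∈ Icc 0 ε, ∀ t ∈ Icc 0 ε,
      ∫ x, inner ℂ (b s x) (v t x) ∂μ = ∫ x, inner ℂ (u s x) (w t x) ∂μ)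
    (hbd : ((∀ x, u 0 x = 0) ∧ ∀ x, u ε x = 0) ∨ ((∀ x, v 0 x = 0) ∧ ∀ x, v ε x = 0)) :
    ∫⁻ t in Icc 0 ε, ∫⁻ x, ENNReal.ofReal
        ((‖Complex.I • (ρ x)⁻¹ • u' t x + w t x‖ ^ 2
          + ‖-(Complex.I • (ρ x)⁻¹ • v' t x) + b t x‖ ^ 2) * ρ x) ∂μ
      = ∫⁻ t in Icc 0 ε, ∫⁻ x, ENNReal.ofReal
        ((ρ x)⁻¹ * (‖u' t x‖ ^ 2 + ‖v' t x‖ ^ 2) + ρ x * (‖w t x‖ ^ 2 + ‖b t x‖ ^ 2)) ∂μ := by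
  have bound : ∀ {α : ℝ → ∀ x, E x},
      ContinuousOn (fun q : ℝ × X ↦ ‖α q.1 q.2‖ ^ 2) (Icc 0 ε ×ˢ univ) →
      ∃ C, ∀ C' ≥ C, ∀ t ∈ Icc 0 ε, ∀ x, ‖α t x‖ ≤ C' := by
    intro α hα
    obtain ⟨C, hC⟩ := (isCompact_Icc.prod isCompact_univ).exists_bound_of_continuousOn hα
    refine ⟨Real.sqrt C, fun C' hC' t ht x ↦ le_trans ?_ hC'⟩
    refine Real.le_sqrt_of_sq_le ?_
    exact (le_abs_self _).trans (hC (t, x) ⟨ht, mem_univ x⟩)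
  obtain ⟨C₁, h₁⟩ := bound cu
  obtain ⟨C₂, h₂⟩ := bound cu'
  obtain ⟨C₃, h₃⟩ := bound cw
  obtain ⟨C₄, h₄⟩ := bound cb
  obtain ⟨C₅, h₅⟩ := bound cv
  obtain ⟨C₆, h₆⟩ := bound cv'
  set C := max C₁ (max C₂ (max C₃ (max C₄ (max C₅ C₆)))) with hC
  have ccross := cuw.add cbv
  have icross := integrable_of_continuousOn_prod (μ := μ) ccross
  have hint : IntervalIntegrable
      (fun t ↦ ∫ x, (inner ℂ (u' t x) (w t x) + inner ℂ (b t x) (v' t x)) ∂μ) volume 0 ε := by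
    rw [intervalIntegrable_iff_integrableOn_Icc_of_le hε.le]
    exact icross.integral_prod_left
  have hzero := integral_pairing_deriv hε hu hv hw (h₁ C (by simp [hC])) (h₂ C (by simp [hC]))
    (h₃ C (by simp [hC])) (h₄ C (by simp [hC])) (h₅ C (by simp [hC])) (h₆ C (by simp [hC]))
    (fun s hs t ht ↦ (muw s hs t ht).aestronglyMeasurable)
    (fun s hs t ht ↦ (mbv s hs t ht).aestronglyMeasurable) hadj hint
  have hend : ∫ x, inner ℂ (u ε x) (w ε x) ∂μ - ∫ x, inner ℂ (u 0 x) (w 0 x) ∂μ = 0 := by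
    have h0 : (0 : ℝ) ∈ Icc 0 ε := ⟨le_rfl, hε.le⟩
    have h1 : ε ∈ Icc 0 ε := ⟨hε.le, le_rfl⟩
    rcases hbd with ⟨ha, hb⟩ | ⟨ha, hb⟩
    · simp [ha, hb]
    · rw [← hadj 0 h0 0 h0, ← hadj ε h1 ε h1]
      simp [ha, hb]
  rw [hend, intervalIntegral.integral_of_le hε.le, ← integral_Icc_eq_integral_Ioc] at hzero
  have c1 : ContinuousOn (fun q : ℝ × X ↦ (ρ q.2)⁻¹ * (‖u' q.1 q.2‖ ^ 2 + ‖v' q.1 q.2‖ ^ 2)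
      + ρ q.2 * (‖w q.1 q.2‖ ^ 2 + ‖b q.1 q.2‖ ^ 2)) (Icc 0 ε ×ˢ univ) := by
    have hρ2 : ContinuousOn (fun q : ℝ × X ↦ ρ q.2) (Icc 0 ε ×ˢ univ) :=
      (hρc.comp continuous_snd).continuousOn
    exact ((hρ2.inv₀ fun q _ ↦ (hρ q.2).ne').mul (cu'.add cv')).add (hρ2.mul (cw.add cb))
  have c2 : ContinuousOn (fun q : ℝ × X ↦
      2 * (inner ℂ (u' q.1 q.2) (w q.1 q.2) + inner ℂ (b q.1 q.2) (v' q.1 q.2)).im)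
      (Icc 0 ε ×ˢ univ) := continuousOn_const.mul (Complex.continuous_im.comp_continuousOn ccross)
  have i2 : ∫ t in Icc 0 ε, ∫ x,
      2 * (inner ℂ (u' t x) (w t x) + inner ℂ (b t x) (v' t x)).im ∂μ = 0 := by
    have h1 : ∀ t ∈ Icc 0 ε, ∫ x, 2 * (inner ℂ (u' t x) (w t x) + inner ℂ (b t x) (v' t x)).im ∂μ
        = 2 * (∫ x, (inner ℂ (u' t x) (w t x) + inner ℂ (b t x) (v' t x)) ∂μ).im := by
      intro t ht
      have hi : Integrable (fun x ↦ inner ℂ (u' t x) (w t x) + inner ℂ (b t x) (v' t x)) μ :=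
        (continuous_slice ccross ht).integrable_of_hasCompactSupport
          (HasCompactSupport.of_compactSpace _)
      rw [integral_const_mul]
      congr 1
      exact integral_im hi
    rw [setIntegral_congr_fun measurableSet_Icc h1, integral_const_mul]
    have h2 : ∫ t in Icc 0 ε,
        (∫ x, (inner ℂ (u' t x) (w t x) + inner ℂ (b t x) (v' t x)) ∂μ).im = 0 := by
      have h3 := integral_im (icross.integral_prod_left)
      have h4 : RCLike.im (∫ t in Icc 0 ε,
        ∫ x, (inner ℂ (u' t x) (w t x) + inner ℂ (b t x) (v' t x)) ∂μ) = 0 := by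
        rw [hzero]
        simp
      exact h3.trans h4
    rw [h2, mul_zero]
  simp_rw [fun t x ↦ norm_sq_dirac_expand (u' t x) (w t x) (v' t x) (b t x) (hρ x)]
  have hpos1 : ∀ q ∈ Icc 0 ε ×ˢ (univ : Set X),
      0 ≤ (ρ q.2)⁻¹ * (‖u' q.1 q.2‖ ^ 2 + ‖v' q.1 q.2‖ ^ 2)
      + ρ q.2 * (‖w q.1 q.2‖ ^ 2 + ‖b q.1 q.2‖ ^ 2) := fun q _ ↦ by
    have := hρ q.2
    positivity
  have hpos2 : ∀ q ∈ Icc 0 ε ×ˢ (univ : Set X),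
      0 ≤ (ρ q.2)⁻¹ * (‖u' q.1 q.2‖ ^ 2 + ‖v' q.1 q.2‖ ^ 2)
      + ρ q.2 * (‖w q.1 q.2‖ ^ 2 + ‖b q.1 q.2‖ ^ 2)
      + 2 * (inner ℂ (u' q.1 q.2) (w q.1 q.2) + inner ℂ (b q.1 q.2) (v' q.1 q.2)).im :=
      fun q _ ↦ by
    rw [← norm_sq_dirac_expand _ _ _ _ (hρ q.2)]
    have := hρ q.2
    positivity
  refine (lintegral_ofReal_eq_of_continuousOn_prod (c1.add c2) hpos2).trans
    (Eq.trans ?_ (lintegral_ofReal_eq_of_continuousOn_prod c1 hpos1).symm)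
  congr 1
  have j1 := integrable_of_continuousOn_prod (μ := μ) c1
  have j2 := integrable_of_continuousOn_prod (μ := μ) c2
  have j3 := integral_prod _ (j1.add j2)
  refine j3.symm.trans ?_
  rw [integral_add' j1 j2, integral_prod _ j1, integral_prod _ j2, i2, add_zero]

end Product

/-! ### The energy of a smooth spinor -/

lemma mul_add_le_energy {a d c b k r s : ℝ} (ha : 0 ≤ a) (hd : 0 ≤ d) (hc : 0 ≤ c) (hb : 0 ≤ b)
    (hr : k ≤ r) (hs : k ≤ s) (hk : 0 ≤ k) : k * (b + d) ≤ r * (a + d) + s * (c + b) := by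
  have e1 := mul_le_mul_of_nonneg_right hs hb
  have e2 := mul_le_mul_of_nonneg_right hr hd
  have e3 := mul_nonneg (hk.trans hr) ha
  have e4 := mul_nonneg (hk.trans hs) hc
  linarith

lemma mul_add_le_energy' {a d c b k r s : ℝ} (ha : 0 ≤ a) (hd : 0 ≤ d) (hc : 0 ≤ c) (hb : 0 ≤ b)
    (hr : k ≤ r) (hs : k ≤ s) (hk : 0 ≤ k) : k * (c + a) ≤ r * (a + d) + s * (c + b) := by
  rw [add_comm a d, add_comm c b, add_comm c a, add_comm a c]
  exact mul_add_le_energy hd ha hb hc hr hs hk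

section SmoothSpinors

variable {X : Type*} [TopologicalSpace X] [ChartedSpace ℂ X] [IsManifold 𝓘(ℂ) ω X]
  {L : X → Type*} [TopologicalSpace (TotalSpace ℂ L)]
  [∀ x, NormedAddCommGroup (L x)] [∀ x, InnerProductSpace ℂ (L x)]
  [FiberBundle ℂ L] [VectorBundle ℂ ℂ L] [VectorBundle ℝ ℂ L]

lemma coordField_self (x : X) : coordField x 1 x = e₂ x := by
  rw [coordField_eq_mul (mem_chart_source ℂ x), coordCoeff_self, one_mul]
  rfl

/-- A family of sections which is continuous in the total space is continuous in each fibre. -/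
lemma continuousOn_fiber {I : Set ℝ} {α : ℝ → ∀ x, L x} {U : Set X}
    (hα : ContinuousOn (fun q : ℝ × X ↦ (⟨q.2, α q.1 q.2⟩ : TotalSpace ℂ L)) (I ×ˢ U))
    {x : X} (hx : x ∈ U) : ContinuousOn (fun t ↦ α t x) I := by
  rw [(FiberBundle.totalSpaceMk_isInducing ℂ L x).continuousOn_iff]
  exact hα.comp (f := fun t : ℝ ↦ (t, x)) (by fun_prop) fun t ht ↦ ⟨ht, hx⟩

/-- The rescaling of the fibre `L x` for which `a ↦ hat c g x (a (e₂ x))` is an isometry from the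
fibre of `Λ^{0,1} ⊗ L` onto `L x`. It allows `𝕊⁻` to be treated like `𝕊⁺`; the resulting
identification is pointwise, and not continuous in `x`. -/
noncomputable def hat (c : ℝ) (g : Metric X) (x : X) (l : L x) : L x :=
  Real.sqrt (c / conf g x) • l

lemma inner_hat {c : ℝ} (hc : 0 < c) (g : Metric X) (x : X) (l l' : L x) :
    inner ℂ (hat c g x l) (hat c g x l') = ((c / conf g x : ℝ) : ℂ) * inner ℂ l l' := by
  rw [hat, hat, ← Complex.coe_smul, ← Complex.coe_smul, inner_smul_left, inner_smul_right,
    Complex.conj_ofReal, ← mul_assoc, ← Complex.ofReal_mul,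
    Real.mul_self_sqrt (div_pos hc (conf_pos g x)).le]

lemma norm_hat_sq {c : ℝ} (hc : 0 < c) (g : Metric X) (x : X) (l : L x) :
    ‖hat c g x l‖ ^ 2 = c / conf g x * ‖l‖ ^ 2 := by
  rw [hat, norm_smul, mul_pow, Real.norm_eq_abs, sq_abs,
    Real.sq_sqrt (div_pos hc (conf_pos g x)).le]

lemma hat_add (c : ℝ) (g : Metric X) (x : X) (l l' : L x) :
    hat c g x (l + l') = hat c g x l + hat c g x l' := smul_add _ _ _

variable {M : Type*} [TopologicalSpace M] {b : M → X} {s : Set M} {β γ : ∀ m, Tan (b m) → L (b m)}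

lemma ContForm.inner_hat (hL : IsSmoothHermitian L) {c : ℝ} (hc : 0 < c) {g : Metric X}
    (hg : IsHermitianMetric g) (hβ : ContForm b s β) (hγ : ContForm b s γ) :
    ContinuousOn (fun m ↦ Inner.inner ℂ (hat c g (b m) (β m (e₂ (b m))))
      (hat c g (b m) (γ m (e₂ (b m))))) s :=
  (hβ.inner hL c hg hγ).congr fun _ _ ↦ ThinDirac.inner_hat hc g _ _ _

lemma ContForm.norm_hat_sq (hL : IsSmoothHermitian L) {c : ℝ} (hc : 0 < c) {g : Metric X}
    (hg : IsHermitianMetric g) (hβ : ContForm b s β) :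
    ContinuousOn (fun m ↦ ‖hat c g (b m) (β m (e₂ (b m)))‖ ^ 2) s := by
  refine (Complex.continuous_re.comp_continuousOn (hβ.inner_hat hL hc hg hβ)).congr fun m _ ↦ ?_
  rw [← inner_self_eq_norm_sq (𝕜 := ℂ)]
  rfl

lemma IsSmoothHermitian.continuousOn_norm_sq (hL : IsSmoothHermitian L) {α : ∀ m, L (b m)}
    (hα : ContinuousOn (fun m ↦ (⟨b m, α m⟩ : TotalSpace ℂ L)) s) :
    ContinuousOn (fun m ↦ ‖α m‖ ^ 2) s := fun m hm ↦ hL.continuousWithinAt_norm_sq (hα m hm)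

lemma IsSmoothHermitian.continuousOn_inner (hL : IsSmoothHermitian L) {α α' : ∀ m, L (b m)}
    (hα : ContinuousOn (fun m ↦ (⟨b m, α m⟩ : TotalSpace ℂ L)) s)
    (hα' : ContinuousOn (fun m ↦ (⟨b m, α' m⟩ : TotalSpace ℂ L)) s) :
    ContinuousOn (fun m ↦ inner ℂ (α m) (α' m)) s := fun m hm ↦
  hL.continuousWithinAt_inner (hα m hm) (hα' m hm)

variable {ε : ℝ} {V : Spinor L}

lemma Spinor.IsSmooth.continuousOn_u (hV : V.IsSmooth ε) :
    ContinuousOn (fun q : ℝ × X ↦ (⟨q.2, V.u q.1 q.2⟩ : TotalSpace ℂ L)) (Icc 0 ε ×ˢ univ) :=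
  hV.1.continuousOn

lemma Spinor.IsSmooth.contForm_v (hV : V.IsSmooth ε) :
    ContForm (Prod.snd : ℝ × X → X) (Icc 0 ε ×ˢ univ) (fun q a ↦ V.v q.1 q.2 a) :=
  contForm_of_continuousOn hV.2.1.continuousOn fun q hq ↦ hV.2.2 q.1 hq.1 q.2

lemma Spinor.IsSmooth.smoothSection_u (hV : V.IsSmooth ε) {t : ℝ} (ht : t ∈ Icc 0 ε) :
    SmoothSection (V.u t) :=
  hV.1.comp_contMDiff (contMDiff_const.prodMk contMDiff_id) fun x ↦ ⟨ht, mem_univ x⟩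

lemma Spinor.IsSmooth.smoothForm01_v (hV : V.IsSmooth ε) {t : ℝ} (ht : t ∈ Icc 0 ε) :
    SmoothForm01 (V.v t) :=
  ⟨hV.2.2 t ht, hV.2.1.comp_contMDiff (contMDiff_const.prodMk contMDiff_id)
    fun x ↦ ⟨ht, mem_univ x⟩⟩

lemma Spinor.IsSmooth.contMDiffOn_v_coordField (hV : V.IsSmooth ε) (p : X) :
    ContMDiffOn (𝓘(ℝ, ℝ).prod 𝓘(ℝ, ℂ)) (𝓘(ℝ, ℂ).prod 𝓘(ℝ, ℂ)) ∞
      (fun q : ℝ × X ↦ (⟨q.2, V.v q.1 q.2 (coordField p 1 q.2)⟩ : TotalSpace ℂ L))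
      (Icc 0 ε ×ˢ (chartAt ℂ p).source) := by
  have h1 := hV.2.1.mono (prod_mono_right (s := Icc 0 ε) (subset_univ (chartAt ℂ p).source))
  have h2 : ContMDiffOn (𝓘(ℝ, ℝ).prod 𝓘(ℝ, ℂ)) (𝓘(ℝ, ℂ).prod 𝓘(ℝ, ℂ)) ∞
      (fun q : ℝ × X ↦
        (⟨q.2, coordField p 1 q.2⟩ : TotalSpace ℂ (fun x : X ↦ Tan x)))
      (Icc 0 ε ×ˢ (chartAt ℂ p).source) :=
    (contMDiffOn_coordField p 1).comp (f := fun q : ℝ × X ↦ q.2) contMDiffOn_snd fun q hq ↦ hq.2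
  exact ContMDiffOn.clm_bundle_apply (F₁ := ℂ) (F₂ := ℂ) (E₁ := fun x : X ↦ Tan x) (E₂ := L)
    (b := fun q : ℝ × X ↦ q.2) (ϕ := fun q ↦ V.v q.1 q.2) h1 h2

variable [ContMDiffVectorBundle ∞ ℂ L 𝓘(ℝ, ℂ)]

lemma Spinor.IsSmooth.hasDerivWithinAt_u (hε : 0 < ε) (hV : V.IsSmooth ε) {t : ℝ}
    (ht : t ∈ Icc 0 ε) (x : X) :
    HasDerivWithinAt (fun s ↦ V.u s x) (dtU ε V t x) (Icc 0 ε) t :=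
  hasDerivWithinAt_of_contMDiffOn hε isOpen_univ hV.1 ht (mem_univ x)

lemma Spinor.IsSmooth.hasDerivWithinAt_v (hε : 0 < ε) (hV : V.IsSmooth ε) {t : ℝ}
    (ht : t ∈ Icc 0 ε) (x : X) :
    HasDerivWithinAt (fun s ↦ V.v s x (e₂ x)) (dtV ε V t x (e₂ x)) (Icc 0 ε) t := by
  have := hasDerivWithinAt_of_contMDiffOn hε (chartAt ℂ x).open_source
    (α := fun s y ↦ V.v s y (coordField x 1 y))
    (hV.contMDiffOn_v_coordField x) ht (mem_chart_source ℂ x)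
  simp only [coordField_self] at this
  exact this

lemma Spinor.IsSmooth.continuousOn_dtU (hε : 0 < ε) (hV : V.IsSmooth ε) :
    ContinuousOn (fun q : ℝ × X ↦ (⟨q.2, dtU ε V q.1 q.2⟩ : TotalSpace ℂ L))
      (Icc 0 ε ×ˢ univ) :=
  continuousOn_derivWithin_section hε isOpen_univ hV.1

lemma Spinor.IsSmooth.contForm_dtV (hε : 0 < ε) (hV : V.IsSmooth ε) :
    ContForm (Prod.snd : ℝ × X → X) (Icc 0 ε ×ˢ univ) (fun q a ↦ dtV ε V q.1 q.2 a) where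
  anti q hq a := by
    have h1 := (hV.hasDerivWithinAt_v hε hq.1 q.2).const_smul ((starRingEnd ℂ) a)
    have h2 : HasDerivWithinAt (fun s ↦ V.v s q.2 (a : ℂ))
        ((starRingEnd ℂ) a • dtV ε V q.1 q.2 (e₂ q.2)) (Icc 0 ε) q.1 :=
      h1.congr_of_mem (fun s hs ↦ antilinear_apply (hV.2.2 s hs q.2) a) hq.1
    exact h2.derivWithin (uniqueDiffOn_Icc hε q.1 hq.1)
  base := continuousOn_snd
  cont p q hq hp := by
    have h1 := continuousOn_derivWithin_section hε (chartAt ℂ p).open_source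
      (α := fun s y ↦ V.v s y (coordField p 1 y)) (hV.contMDiffOn_v_coordField p)
    refine (h1 q ⟨hq.1, hp⟩).mono_of_mem_nhdsWithin ?_
    rw [← Prod.mk.eta (p := q), nhdsWithin_prod_eq]
    exact prod_mem_prod self_mem_nhdsWithin
      (mem_nhdsWithin_of_mem_nhds ((chartAt ℂ p).open_source.mem_nhds hp))

variable [MeasurableSpace X] {c : ℝ} {g : Metric X} {nabla : CovariantDerivative 𝓘(ℝ, ℂ) ℂ L}
  {h : X → ℝ} {W : Spinor L}

/-- For a smooth spinor `V = (u, v)` in the domain of the Dirac operator, `∂̄ u` is a continuous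
family of forms. -/
lemma IsDirac.contForm_dbar (hε : 0 < ε) (hh : Continuous h) (h0 : ∀ x, 0 < h x)
    (hV : V.IsSmooth ε) (hVW : IsDirac c g nabla h ε V W) :
    ContForm (Prod.snd : ℝ × X → X) (Icc 0 ε ×ˢ univ)
      (fun q a ↦ dbar nabla (V.u q.1) q.2 a) := by
  have hρ : ContinuousOn (fun q : ℝ × X ↦ Complex.I * (((Real.sqrt (h q.2))⁻¹ : ℝ) : ℂ))
      (Icc 0 ε ×ˢ univ) := by
    refine continuousOn_const.mul (Complex.continuous_ofReal.comp_continuousOn ?_)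
    exact ((Real.continuous_sqrt.comp (hh.comp continuous_snd)).inv₀
      fun q ↦ (Real.sqrt_pos.2 (h0 q.2)).ne').continuousOn
  refine (hVW.1.contForm_v.add ((hV.contForm_dtV hε).smul hρ)).congr fun q hq a ↦ ?_
  rw [(hVW.2 q.1 hq.1).2 q.2 a, mul_smul, Complex.coe_smul]
  abel

lemma IsDirac.continuousOn_dbarStar (hε : 0 < ε) (hh : Continuous h) (h0 : ∀ x, 0 < h x)
    (hV : V.IsSmooth ε) (hVW : IsDirac c g nabla h ε V W) :
    ContinuousOn (fun q : ℝ × X ↦ (⟨q.2, W.u q.1 q.2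
      - Complex.I • (Real.sqrt (h q.2))⁻¹ • dtU ε V q.1 q.2⟩ : TotalSpace ℂ L))
      (Icc 0 ε ×ˢ univ) := by
  have hρ : ContinuousOn (fun q : ℝ × X ↦ -(Complex.I * (((Real.sqrt (h q.2))⁻¹ : ℝ) : ℂ)))
      (Icc 0 ε ×ˢ univ) := by
    refine (continuousOn_const.mul (Complex.continuous_ofReal.comp_continuousOn ?_)).neg
    exact ((Real.continuous_sqrt.comp (hh.comp continuous_snd)).inv₀
      fun q ↦ (Real.sqrt_pos.2 (h0 q.2)).ne').continuousOn
  intro q hq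
  have := continuousWithinAt_add_section (hVW.1.continuousOn_u q hq)
    (continuousWithinAt_smul_section (hρ q hq) (hV.continuousOn_dtU hε q hq))
  refine this.congr_of_mem (fun q' _ ↦ ?_) hq
  rw [neg_smul, mul_smul, Complex.coe_smul, ← sub_eq_add_neg]

variable [T2Space X] [CompactSpace X] [BorelSpace X]

set_option maxHeartbeats 1000000 in
/-- The Dirac energy of a smooth spinor, one of whose components vanishes on the boundary, is
bounded from below by any `m ≤ 2 / ε²` which is a lower bound for the slice operator on the other
component. -/
lemma IsDirac.energy_bound (hg : IsHermitianMetric g) (hL : IsSmoothHermitian L) (hc : 0 < c)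
    (hh : Continuous h) {K : ℝ} (hK : 0 < K) (hhK : ∀ x, 1 / K ≤ h x ∧ h x ≤ K) (hε : 0 < ε)
    (hV : V.IsSmooth ε) (hVW : IsDirac c g nabla h ε V W) {m : ℝ≥0∞}
    (hm : m ≤ ENNReal.ofReal (2 / ε ^ 2))
    (hcase : (((∀ x, V.v 0 x = 0) ∧ ∀ x, V.v ε x = 0) ∧
        ∀ t ∈ Icc 0 ε, m * l2Sq g (V.u t) ≤ l2Sq01 c g (dbar nabla (V.u t))) ∨
      (((∀ x, V.u 0 x = 0) ∧ ∀ x, V.u ε x = 0) ∧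
        ∀ t ∈ Icc 0 ε, m * l2Sq01 c g (V.v t) ≤ l2Sq g
          (fun x ↦ W.u t x - Complex.I • (Real.sqrt (h x))⁻¹ • dtU ε V t x))) :
    ENNReal.ofReal (1 / K) * m * V.l2Sq c g h ε ≤ W.l2Sq c g h ε := by
  have := ChartedSpace.secondCountable_of_sigmaCompact ℂ X
  have := isFiniteMeasure_area hg
  have h0 : ∀ x, 0 < h x := fun x ↦ (by positivity : 0 < 1 / K).trans_le (hhK x).1
  set ρ : X → ℝ := fun x ↦ Real.sqrt (h x) with hρ
  have hρ0 : ∀ x, 0 < ρ x := fun x ↦ Real.sqrt_pos.2 (h0 x)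
  have hρc : Continuous ρ := Real.continuous_sqrt.comp hh
  have hρK : ∀ x, ρ x ≤ Real.sqrt K := fun x ↦ Real.sqrt_le_sqrt (hhK x).2
  have hρK' : ∀ x, (Real.sqrt K)⁻¹ ≤ ρ x := fun x ↦ by
    rw [← Real.sqrt_inv, ← one_div]
    exact Real.sqrt_le_sqrt (hhK x).1
  have hρK'' : ∀ x, (Real.sqrt K)⁻¹ ≤ (ρ x)⁻¹ := fun x ↦ inv_anti₀ (hρ0 x) (hρK x)
  set u' : ℝ → ∀ x, L x := fun t x ↦ dtU ε V t x with hu'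
  set w : ℝ → ∀ x, L x := fun t x ↦ W.u t x - Complex.I • (ρ x)⁻¹ • dtU ε V t x with hw
  set v : ℝ → ∀ x, L x := fun t x ↦ hat c g x (V.v t x (e₂ x)) with hv
  set v' : ℝ → ∀ x, L x := fun t x ↦ hat c g x (dtV ε V t x (e₂ x)) with hv'
  set b : ℝ → ∀ x, L x := fun t x ↦ hat c g x (dbar nabla (V.u t) x (e₂ x)) with hb
  have su := hV.continuousOn_u
  have su' := hV.continuousOn_dtU hε
  have sw := hVW.continuousOn_dbarStar hε hh h0 hV
  have fv := hV.contForm_v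
  have fv' := hV.contForm_dtV hε
  have fb := hVW.contForm_dbar hε hh h0 hV
  have cu := hL.continuousOn_norm_sq su
  have cu' := hL.continuousOn_norm_sq su'
  have cw := hL.continuousOn_norm_sq sw
  have cv := fv.norm_hat_sq hL hc hg
  have cv' := fv'.norm_hat_sq hL hc hg
  have cb := fb.norm_hat_sq hL hc hg
  have du : ∀ x, ∀ t ∈ Icc 0 ε, HasDerivWithinAt (fun s ↦ V.u s x) (u' t x) (Icc 0 ε) t :=
    fun x t ht ↦ hV.hasDerivWithinAt_u hε ht x
  have dv : ∀ x, ∀ t ∈ Icc 0 ε, HasDerivWithinAt (fun s ↦ v s x) (v' t x) (Icc 0 ε) t :=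
    fun x t ht ↦ (hV.hasDerivWithinAt_v hε ht x).const_smul (Real.sqrt (c / conf g x))
  have slice : ∀ {α : ℝ → ∀ x, L x}, ContinuousOn
      (fun q : ℝ × X ↦ (⟨q.2, α q.1 q.2⟩ : TotalSpace ℂ L)) (Icc 0 ε ×ˢ univ) →
      ∀ t ∈ Icc 0 ε, Continuous (fun x : X ↦ (⟨x, α t x⟩ : TotalSpace ℂ L)) :=
    fun hα t ht ↦ continuous_slice hα ht
  have fslice : ∀ {β : ∀ q : ℝ × X, Tan q.2 → L q.2},
      ContForm (Prod.snd : ℝ × X → X) (Icc 0 ε ×ˢ univ) β → ∀ t ∈ Icc 0 ε,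
      ContForm (fun x : X ↦ x) univ (fun x a ↦ β (t, x) a) :=
    fun hβ t ht ↦ hβ.comp (φ := fun x : X ↦ (t, x)) (by fun_prop) fun x _ ↦ ⟨ht, mem_univ x⟩
  have hbd : ((∀ x, V.u 0 x = 0) ∧ ∀ x, V.u ε x = 0) ∨ ((∀ x, v 0 x = 0) ∧ ∀ x, v ε x = 0) := by
    rcases hcase with ⟨⟨h1, h2⟩, -⟩ | ⟨h1, -⟩
    · exact Or.inr ⟨fun x ↦ by simp [hv, h1, hat], fun x ↦ by simp [hv, h2, hat]⟩
    · exact Or.inl h1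
  have key := lintegral_dirac_eq (μ := area g) hε (u := V.u) (u' := u') (w := w) (b := b) (v := v)
    (v' := v') hρc hρ0 du dv (fun x ↦ continuousOn_fiber sw (mem_univ x)) cu cu' cw cb cv cv'
    (hL.continuousOn_inner su' sw) (fb.inner_hat hL hc hg fv')
    (fun s hs t ht ↦ by
      rw [← continuousOn_univ]
      exact hL.continuousOn_inner (b := fun x : X ↦ x) (slice su s hs).continuousOn
        (slice sw t ht).continuousOn)
    (fun s hs t ht ↦ by
      rw [← continuousOn_univ]
      exact (fslice fb s hs).inner_hat hL hc hg (fslice fv t ht))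
    (fun s hs t ht ↦ by
      have := ((hVW.2 t ht).1).2 (V.u s) (hV.smoothSection_u hs)
      rw [← this]
      refine integral_congr_ae (ae_of_all _ fun x ↦ ?_)
      exact inner_hat hc g x _ _) hbd
  have hWeq : W.l2Sq c g h ε = ∫⁻ t in Icc 0 ε, ∫⁻ x, ENNReal.ofReal
        ((ρ x)⁻¹ * (‖u' t x‖ ^ 2 + ‖v' t x‖ ^ 2) + ρ x * (‖w t x‖ ^ 2 + ‖b t x‖ ^ 2))
        ∂(area g) := by
    rw [← key, Spinor.l2Sq]
    refine setLIntegral_congr_fun measurableSet_Icc fun t ht ↦ lintegral_congr fun x ↦ ?_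
    congr 3
    · simp only [hu', hw]
      congr 2
      abel
    · rw [normSq01, ← norm_hat_sq hc, (hVW.2 t ht).2 x (e₂ x), hat_add]
      congr 3
      simp only [hv', hat, smul_neg, smul_comm (Real.sqrt (c / conf g x))]
      rfl
  have hVeq : V.l2Sq c g h ε = ∫⁻ t in Icc 0 ε, ∫⁻ x, ENNReal.ofReal
        ((‖V.u t x‖ ^ 2 + ‖v t x‖ ^ 2) * ρ x) ∂(area g) := by
    refine lintegral_congr fun t ↦ lintegral_congr fun x ↦ ?_
    rw [normSq01, ← norm_hat_sq hc]
  have hn : ∀ (α : ℝ → ∀ x, L x), ∀ q : ℝ × X, 0 ≤ ‖α q.1 q.2‖ ^ 2 := fun _ _ ↦ by positivity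
  rw [hWeq, hVeq]
  rcases hcase with ⟨⟨h1, -⟩, hs⟩ | ⟨⟨h1, -⟩, hs⟩
  · refine energy_lower_bound hK cu cb cv cv' (hn V.u) (hn b) (hn v) (hn v') ?_ ?_ hρK
      (e := fun q ↦ (ρ q.2)⁻¹ * (‖u' q.1 q.2‖ ^ 2 + ‖v' q.1 q.2‖ ^ 2)
        + ρ q.2 * (‖w q.1 q.2‖ ^ 2 + ‖b q.1 q.2‖ ^ 2)) ?_
    · intro t ht
      refine (hs t ht).trans (le_of_eq (lintegral_congr fun x ↦ ?_))
      rw [normSq01, ← norm_hat_sq hc]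
    · intro x
      refine (mul_le_mul_left hm _).trans ?_
      refine poincare_inequality hε (dv x) ?_ (by simp [hv, h1, hat])
      have := continuousOn_fiber (α := fun t y ↦ dtV ε V t y (coordField x 1 y))
        (U := {x}) (I := Icc 0 ε) (fun q hq ↦ by
          have hq2 : q.2 = x := hq.2
          refine ((fv'.cont x q ⟨hq.1, mem_univ _⟩ ?_).mono (prod_mono_right (subset_univ _)))
          rw [hq2]
          exact mem_chart_source ℂ x) (mem_singleton x)
      simp only [coordField_self] at this
      exact this.const_smul _
    · intro q _
      exact mul_add_le_energy (hn u' q) (hn v' q) (hn w q) (hn b q) (hρK'' q.2) (hρK' q.2)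
        (inv_nonneg.2 (Real.sqrt_nonneg K))
  · simp_rw [fun t x ↦ add_comm (‖V.u t x‖ ^ 2) (‖v t x‖ ^ 2)]
    refine energy_lower_bound hK cv cw cu cu' (hn v) (hn w) (hn V.u) (hn u') ?_ ?_ hρK
      (e := fun q ↦ (ρ q.2)⁻¹ * (‖u' q.1 q.2‖ ^ 2 + ‖v' q.1 q.2‖ ^ 2)
        + ρ q.2 * (‖w q.1 q.2‖ ^ 2 + ‖b q.1 q.2‖ ^ 2)) ?_
    · intro t ht
      refine le_trans (le_of_eq ?_) (hs t ht)
      congr 1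
      refine lintegral_congr fun x ↦ ?_
      rw [normSq01, ← norm_hat_sq hc]
    · intro x
      refine (mul_le_mul_left hm _).trans ?_
      exact poincare_inequality hε (du x) (continuousOn_fiber su' (mem_univ x)) (h1 x)
    · intro q _
      exact mul_add_le_energy' (hn u' q) (hn v' q) (hn w q) (hn b q) (hρK'' q.2) (hρK' q.2)
        (inv_nonneg.2 (Real.sqrt_nonneg K))

end SmoothSpinors

/-! ### The Rayleigh quotients of the slices -/

section Slices

variable {X : Type*} [TopologicalSpace X] [T2Space X] [CompactSpace X] [ChartedSpace ℂ X]
  [IsManifold 𝓘(ℂ) ω X]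
  {L : X → Type*} [TopologicalSpace (TotalSpace ℂ L)]
  [∀ x, NormedAddCommGroup (L x)] [∀ x, InnerProductSpace ℂ (L x)]
  [FiberBundle ℂ L] [VectorBundle ℂ ℂ L] [VectorBundle ℝ ℂ L]
  [MeasurableSpace X] [BorelSpace X] {c : ℝ} {g : Metric X}
  {nabla : CovariantDerivative 𝓘(ℝ, ℂ) ℂ L}

/-- As the surface is metrizable, continuous maps out of it are strongly measurable, whether or not
the target is metrizable. -/
lemma aestronglyMeasurable_of_continuous {Z : Type*} [TopologicalSpace Z] {f : X → Z}
    (hf : Continuous f) (μ : Measure X) : AEStronglyMeasurable f μ := by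
  have := ChartedSpace.secondCountable_of_sigmaCompact ℂ X
  exact (hf.comp_stronglyMeasurable stronglyMeasurable_id).aestronglyMeasurable

lemma sobSq_self (u : ∀ x, L x) : sobSq g nabla (fun x ↦ u x - u x) = 0 := by
  have h0 : (fun x ↦ u x - u x) = (0 : ∀ x, L x) := funext fun x ↦ sub_self _
  rw [h0]
  simp [sobSq, gradSq, nabla.zero]

lemma sobSq01_self (v : ∀ x, Tan x →L[ℝ] L x) :
    sobSq01 c g nabla (fun x ↦ v x - v x) = 0 := by
  have h0 : (fun x ↦ v x - v x) = (0 : ∀ x, Tan x →L[ℝ] L x) := funext fun x ↦ sub_self _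
  have h1 : ∀ (x : X) (a : ℂ), covDeriv01 g nabla (0 : ∀ x, Tan x →L[ℝ] L x) x a = 0 := by
    intro x a
    have h2 : (fun y ↦ (0 : ∀ x, Tan x →L[ℝ] L x) y (coordField x 1 y)) = (0 : ∀ x, L x) := rfl
    rw [covDeriv01, h2, nabla.zero]
    exact sub_self (0 : L x)
  rw [h0]
  simp [sobSq01, gradSq01, h1, normSq01]

lemma l2Sq_self (u : ∀ x, L x) : l2Sq g (fun x ↦ u x - u x) = 0 := by simp [l2Sq]

lemma l2Sq01_self (v : ∀ x, Tan x →L[ℝ] L x) : l2Sq01 c g (fun x ↦ v x - v x) = 0 := by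
  simp [l2Sq01, normSq01]

/-- The variational bound `λ_{∂^-} ‖u‖² ≤ ‖∂̄ u‖²` for smooth sections with continuous `∂̄ u`; the
constant sequence `u` exhibits `u` as a member of the domain of `∂^-`. -/
lemma lamDelMinus_mul_le {u : ∀ x, L x} (hu : SmoothSection u)
    (hb : ContForm (fun x : X ↦ x) univ (fun x a ↦ dbar nabla u x a)) :
    lamDelMinus c g nabla * l2Sq g u ≤ l2Sq01 c g (dbar nabla u) := by
  by_cases h0 : l2Sq g u = 0
  · simp [h0]
  have hIb : ContForm (fun x : X ↦ x) univ (fun x a ↦ (Complex.I • dbar nabla u x) a) :=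
    hb.smul (f := fun _ ↦ Complex.I) continuousOn_const
  have hform : IsForm01 (fun x ↦ Complex.I • dbar nabla u x) := by
    intro x a
    have hI : ∀ z : ℂ, Complex.I • Complex.I • z = -z := fun z ↦ by
      rw [smul_smul, Complex.I_mul_I, neg_one_smul]
    have hJ : rotJ x (rotJ x a) = -a := hI a
    simp only [dbar, smul_apply, add_apply, ContinuousLinearMap.comp_apply, hJ, map_neg]
    rw [smul_comm Complex.I (2⁻¹ : ℝ), smul_comm Complex.I (2⁻¹ : ℝ),
      smul_comm Complex.I (2⁻¹ : ℝ), ← smul_neg]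
    congr 1
    simp only [smul_add, smul_smul, smul_neg, Complex.I_mul_I, neg_smul, one_smul]
    abel
  have hdel : DelMinus c g nabla u (fun x ↦ Complex.I • dbar nabla u x) := by
    refine ⟨aestronglyMeasurable_of_continuous hu.continuous _,
      ⟨hform, aestronglyMeasurable_of_continuous hIb.continuous_section _⟩,
      fun _ ↦ u, fun _ ↦ hu, fun η hη ↦ ⟨0, fun _ _ _ _ ↦ ?_⟩, ?_, ?_⟩
    · rw [sobSq_self]
      exact hη
    · simp_rw [l2Sq_self]
      exact tendsto_const_nhds
    · simp_rw [l2Sq01_self]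
      exact tendsto_const_nhds
  have hle : lamDelMinus c g nabla
      ≤ l2Sq01 c g (fun x ↦ Complex.I • dbar nabla u x) / l2Sq g u :=
    iInf_le_of_le u (iInf_le_of_le _ (iInf_le_of_le hdel (iInf_le _ h0)))
  refine (ENNReal.mul_le_of_le_div hle).trans (le_of_eq (lintegral_congr fun x ↦ ?_))
  rw [normSq01, normSq01, smul_apply, norm_smul, Complex.norm_I, one_mul]

/-- The variational bound `λ_{∂^+} ‖v‖² ≤ ‖∂̄* v‖²` for smooth forms. -/
lemma lamDelPlus_mul_le {v : ∀ x, Tan x →L[ℝ] L x} {w : ∀ x, L x} (hv : SmoothForm01 v)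
    (hw : IsDbarStar c g nabla v w) :
    lamDelPlus c g nabla * l2Sq01 c g v ≤ l2Sq g w := by
  by_cases h0 : l2Sq01 c g v = 0
  · simp [h0]
  have hcont : Continuous (fun x ↦ (⟨x, -(Complex.I • w x)⟩ : TotalSpace ℂ L)) := by
    rw [← continuousOn_univ]
    intro x _
    have := continuousWithinAt_smul_section (b := fun x : X ↦ x) (α := w) (s := univ) (m := x)
      (f := fun _ ↦ -Complex.I) continuousWithinAt_const
      hw.1.continuous.continuousWithinAt
    simpa only [neg_smul] using this
  have hdel : DelPlus c g nabla v (fun x ↦ -(Complex.I • w x)) := by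
    refine ⟨⟨hv.1, aestronglyMeasurable_of_continuous hv.2.continuous _⟩,
      aestronglyMeasurable_of_continuous hcont _,
      fun _ ↦ v, fun _ ↦ w, fun _ ↦ ⟨hv, hw⟩, fun η hη ↦ ⟨0, fun _ _ _ _ ↦ ?_⟩, ?_, ?_⟩
    · rw [sobSq01_self]
      exact hη
    · simp_rw [l2Sq01_self]
      exact tendsto_const_nhds
    · simp_rw [l2Sq_self]
      exact tendsto_const_nhds
  have hle : lamDelPlus c g nabla ≤ l2Sq g (fun x ↦ -(Complex.I • w x)) / l2Sq01 c g v :=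
    iInf_le_of_le v (iInf_le_of_le _ (iInf_le_of_le hdel (iInf_le _ h0)))
  refine (ENNReal.mul_le_of_le_div hle).trans (le_of_eq (lintegral_congr fun x ↦ ?_))
  rw [norm_neg, norm_smul, Complex.norm_I, one_mul]

end Slices

/-! ### Passing to the closure of the smooth spinors -/

section Closure

variable {X : Type*} [TopologicalSpace X] [T2Space X] [CompactSpace X] [ChartedSpace ℂ X]
  [IsManifold 𝓘(ℂ) ω X]
  {L : X → Type*} [TopologicalSpace (TotalSpace ℂ L)]
  [∀ x, NormedAddCommGroup (L x)] [∀ x, InnerProductSpace ℂ (L x)]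
  [FiberBundle ℂ L] [VectorBundle ℂ ℂ L] [VectorBundle ℝ ℂ L]
  [MeasurableSpace X] [BorelSpace X] {c : ℝ} {g : Metric X}
  {nabla : CovariantDerivative 𝓘(ℝ, ℂ) ℂ L} {h : X → ℝ} {ε : ℝ}

/-- The density, with respect to the product of Lebesgue measure and `area g`, of the
squared `L²`-norm of a spinor. -/
noncomputable def Spinor.density (c : ℝ) (g : Metric X) (h : X → ℝ) (V : Spinor L) (q : ℝ × X) :
    ℝ≥0∞ :=
  ENNReal.ofReal ((‖V.u q.1 q.2‖ ^ 2 + normSq01 c g q.2 (V.v q.1 q.2)) * Real.sqrt (h q.2))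

lemma Spinor.IsMeas.aemeasurable_density (hg : IsHermitianMetric g) (hL : IsSmoothHermitian L)
    (hh : Continuous h) {V : Spinor L} (hV : V.IsMeas g ε) :
    AEMeasurable (V.density c g h) ((volume.restrict (Icc 0 ε)).prod (area g)) := by
  have := isFiniteMeasure_area hg
  have := ChartedSpace.secondCountable_of_sigmaCompact ℂ X
  have h1 := hL.continuous_norm_sq.comp_aestronglyMeasurable hV.1
  have h2 := (hL.continuous_frame_sum c hg).comp_aestronglyMeasurable hV.2.1
  have h3 : AEStronglyMeasurable (fun q : ℝ × X ↦ Real.sqrt (h q.2))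
      ((volume.restrict (Icc 0 ε)).prod (area g)) :=
    (Real.continuous_sqrt.comp (hh.comp continuous_snd)).aestronglyMeasurable
  refine ((h1.add h2).mul h3).aemeasurable.ennreal_ofReal.congr ?_
  rw [restrict_Icc_prod]
  filter_upwards [ae_restrict_mem (measurableSet_Icc.prod MeasurableSet.univ)] with q hq
  simp only [Spinor.density, Pi.mul_apply, Pi.add_apply]
  rw [normSq01_eq_frame_sum c g q.2 (hV.2.2 q.1 hq.1 q.2)]

lemma Spinor.IsSmooth.continuousOn_density (hg : IsHermitianMetric g) (hL : IsSmoothHermitian L)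
    (hc : 0 < c) (hh : Continuous h) {V : Spinor L} (hV : V.IsSmooth ε) :
    ContinuousOn (fun q : ℝ × X ↦
      (‖V.u q.1 q.2‖ ^ 2 + normSq01 c g q.2 (V.v q.1 q.2)) * Real.sqrt (h q.2))
      (Icc 0 ε ×ˢ univ) := by
  refine ((hL.continuousOn_norm_sq hV.continuousOn_u).add ?_).mul
    (Real.continuous_sqrt.comp (hh.comp continuous_snd)).continuousOn
  refine (hV.contForm_v.norm_hat_sq hL hc hg).congr fun q _ ↦ ?_
  rw [normSq01, ← norm_hat_sq hc]

lemma norm_sq_le_of_add {E : Type*} [NormedAddCommGroup E] {η : ℝ} (hη : 0 < η) {a b d : E}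
    (h : a = b + d) : ‖a‖ ^ 2 ≤ (1 + η) * ‖b‖ ^ 2 + (1 + η⁻¹) * ‖d‖ ^ 2 := by
  have h1 : ‖a‖ ≤ ‖b‖ + ‖d‖ := h ▸ norm_add_le b d
  have h2 : ‖a‖ ^ 2 ≤ (‖b‖ + ‖d‖) ^ 2 := by gcongr
  have h3 : 0 ≤ η⁻¹ * (η * ‖b‖ - ‖d‖) ^ 2 := by positivity
  have h4 : η⁻¹ * (η * ‖b‖ - ‖d‖) ^ 2 = η * ‖b‖ ^ 2 - 2 * ‖b‖ * ‖d‖ + η⁻¹ * ‖d‖ ^ 2 := by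
    field_simp
    ring
  nlinarith

lemma normSq01_nonneg (hc : 0 < c) (x : X) (a : Tan x →L[ℝ] L x) : 0 ≤ normSq01 c g x a :=
  mul_nonneg (div_pos hc (conf_pos g x)).le (by positivity)

/-- A quantitative triangle inequality for the squared norm of `A = B + D`. -/
lemma Spinor.l2Sq_le_add (hg : IsHermitianMetric g) (hc : 0 < c) {η : ℝ} (hη : 0 < η)
    {A B D : Spinor L}
    (hB : AEMeasurable (B.density c g h) ((volume.restrict (Icc 0 ε)).prod (area g)))
    (hu : ∀ t x, A.u t x = B.u t x + D.u t x) (hv : ∀ t x, A.v t x = B.v t x + D.v t x) :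
    A.l2Sq c g h ε ≤ ENNReal.ofReal (1 + η) * B.l2Sq c g h ε
      + ENNReal.ofReal (1 + η⁻¹) * D.l2Sq c g h ε := by
  have := isFiniteMeasure_area hg
  have hpt : ∀ t x, A.density c g h (t, x) ≤ ENNReal.ofReal (1 + η) * B.density c g h (t, x)
      + ENNReal.ofReal (1 + η⁻¹) * D.density c g h (t, x) := by
    intro t x
    simp only [Spinor.density]
    have hB0 := normSq01_nonneg (g := g) hc x (B.v t x)
    have hD0 := normSq01_nonneg (g := g) hc x (D.v t x)
    rw [← ENNReal.ofReal_mul (by positivity), ← ENNReal.ofReal_mul (by positivity),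
      ← ENNReal.ofReal_add (by positivity) (by positivity)]
    refine ENNReal.ofReal_le_ofReal ?_
    have h1 := norm_sq_le_of_add hη (hu t x)
    have h2 : normSq01 c g x (A.v t x) ≤ (1 + η) * normSq01 c g x (B.v t x)
        + (1 + η⁻¹) * normSq01 c g x (D.v t x) := by
      have h3 := norm_sq_le_of_add hη (a := A.v t x (e₂ x)) (b := B.v t x (e₂ x))
        (d := D.v t x (e₂ x)) (by rw [hv, add_apply])
      have h4 := mul_le_mul_of_nonneg_left h3 (div_pos hc (conf_pos g x)).le
      simp only [normSq01]
      linarith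
    have h5 := mul_le_mul_of_nonneg_right (add_le_add h1 h2) (Real.sqrt_nonneg (h x))
    linarith
  have hin : ∀ᵐ t ∂(volume.restrict (Icc 0 ε)),
      AEMeasurable (fun x ↦ B.density c g h (t, x)) (area g) :=
    hB.aestronglyMeasurable.prodMk_left.mono fun t ht ↦ ht.aemeasurable
  change ∫⁻ t in Icc 0 ε, ∫⁻ x, A.density c g h (t, x) ∂(area g)
    ≤ ENNReal.ofReal (1 + η) * (∫⁻ t in Icc 0 ε, ∫⁻ x, B.density c g h (t, x) ∂(area g))
      + ENNReal.ofReal (1 + η⁻¹) * ∫⁻ t in Icc 0 ε, ∫⁻ x, D.density c g h (t, x) ∂(area g)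
  rw [← lintegral_const_mul' _ _ ENNReal.ofReal_ne_top,
    ← lintegral_const_mul' _ _ ENNReal.ofReal_ne_top,
    ← lintegral_add_left' (hB.lintegral_prod_right'.const_mul _)]
  refine lintegral_mono_ae (hin.mono fun t ht ↦ ?_)
  rw [← lintegral_const_mul' _ _ ENNReal.ofReal_ne_top,
    ← lintegral_const_mul' _ _ ENNReal.ofReal_ne_top, ← lintegral_add_left' (ht.const_mul _)]
  exact lintegral_mono (hpt t)

lemma Spinor.l2Sq_eq_of_neg {A B : Spinor L} (hu : ∀ t x, A.u t x = -B.u t x)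
    (hv : ∀ t x, A.v t x = -B.v t x) : A.l2Sq c g h ε = B.l2Sq c g h ε := by
  simp [Spinor.l2Sq, normSq01, hu, hv]

/-- An energy bound for the smooth spinors of a class `T` extends to the `L^{1,2}`-closure
of `T`, and the norm is finite on this closure. -/
lemma DiracGraph.energy_bound (hg : IsHermitianMetric g) (hL : IsSmoothHermitian L) (hc : 0 < c)
    (hh : Continuous h) {T : Spinor L → Prop} (hT : ∀ V, T V → V.IsSmooth ε) {k : ℝ≥0∞}
    (hk : k ≠ ⊤)
    (hbound : ∀ V W, T V → IsDirac c g nabla h ε V W → k * V.l2Sq c g h ε ≤ W.l2Sq c g h ε)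
    {V W : Spinor L} (hVW : DiracGraph c g nabla h ε T V W) :
    V.l2Sq c g h ε ≠ ⊤ ∧ k * V.l2Sq c g h ε ≤ W.l2Sq c g h ε := by
  have := isFiniteMeasure_area hg
  have := ChartedSpace.secondCountable_of_sigmaCompact ℂ X
  obtain ⟨-, hW, s, r, hsr, -, hs, hr⟩ := hVW
  have h1 : ∀ n, ∀ η : ℝ, 0 < η → V.l2Sq c g h ε ≤ ENNReal.ofReal (1 + η) * (s n).l2Sq c g h ε
      + ENNReal.ofReal (1 + η⁻¹) * ((s n).diff V).l2Sq c g h ε := by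
    intro n η hη
    have hD : (V.diff (s n)).l2Sq c g h ε = ((s n).diff V).l2Sq c g h ε :=
      Spinor.l2Sq_eq_of_neg (fun t x ↦ by simp [Spinor.diff]) (fun t x ↦ by simp [Spinor.diff])
    rw [← hD]
    refine Spinor.l2Sq_le_add hg hc hη (D := V.diff (s n)) ?_ (fun t x ↦ by simp [Spinor.diff])
      (fun t x ↦ by simp [Spinor.diff])
    exact aemeasurable_ofReal_of_continuousOn_prod
      ((hT _ (hsr n).1).continuousOn_density hg hL hc hh)
  have h2 : ∀ n, ∀ η : ℝ, 0 < η → (r n).l2Sq c g h ε ≤ ENNReal.ofReal (1 + η) * W.l2Sq c g h ε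
      + ENNReal.ofReal (1 + η⁻¹) * ((r n).diff W).l2Sq c g h ε := fun n η hη ↦
    Spinor.l2Sq_le_add hg hc hη (hW.aemeasurable_density hg hL hh)
      (fun t x ↦ by simp [Spinor.diff]) (fun t x ↦ by simp [Spinor.diff])
  refine ⟨?_, ?_⟩
  · obtain ⟨n, hn⟩ := (hs.eventually (gt_mem_nhds ENNReal.zero_lt_top)).exists
    refine ((h1 n 1 one_pos).trans_lt (ENNReal.add_lt_top.2
      ⟨ENNReal.mul_lt_top ENNReal.ofReal_lt_top ?_,
        ENNReal.mul_lt_top ENNReal.ofReal_lt_top hn⟩)).ne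
    refine lintegral_ofReal_lt_top_of_continuousOn_prod
      ((hT _ (hsr n).1).continuousOn_density hg hL hc hh) fun q _ ↦ ?_
    have := normSq01_nonneg (g := g) hc q.2 ((s n).v q.1 q.2)
    positivity
  · have h3 : ∀ η : ℝ, 0 < η → k * V.l2Sq c g h ε
        ≤ ENNReal.ofReal (1 + η) * (ENNReal.ofReal (1 + η) * W.l2Sq c g h ε) := by
      intro η hη
      have h4 : ∀ n, k * V.l2Sq c g h ε
          ≤ ENNReal.ofReal (1 + η) * (ENNReal.ofReal (1 + η) * W.l2Sq c g h ε
            + ENNReal.ofReal (1 + η⁻¹) * ((r n).diff W).l2Sq c g h ε)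
            + k * ENNReal.ofReal (1 + η⁻¹) * ((s n).diff V).l2Sq c g h ε := by
        intro n
        calc k * V.l2Sq c g h ε
            ≤ k * (ENNReal.ofReal (1 + η) * (s n).l2Sq c g h ε
              + ENNReal.ofReal (1 + η⁻¹) * ((s n).diff V).l2Sq c g h ε) := by
              gcongr
              exact h1 n η hη
          _ = ENNReal.ofReal (1 + η) * (k * (s n).l2Sq c g h ε)
              + k * ENNReal.ofReal (1 + η⁻¹) * ((s n).diff V).l2Sq c g h ε := by ring
          _ ≤ _ := by
              gcongr
              exact (hbound _ _ (hsr n).1 (hsr n).2).trans (h2 n η hη)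
      have hlim : Tendsto (fun n ↦ ENNReal.ofReal (1 + η) * (ENNReal.ofReal (1 + η) *
            W.l2Sq c g h ε + ENNReal.ofReal (1 + η⁻¹) * ((r n).diff W).l2Sq c g h ε)
            + k * ENNReal.ofReal (1 + η⁻¹) * ((s n).diff V).l2Sq c g h ε) atTop
          (𝓝 (ENNReal.ofReal (1 + η) * (ENNReal.ofReal (1 + η) *
            W.l2Sq c g h ε + ENNReal.ofReal (1 + η⁻¹) * 0)
            + k * ENNReal.ofReal (1 + η⁻¹) * 0)) := by
        refine Tendsto.add (ENNReal.Tendsto.const_mul (tendsto_const_nhds.add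
          (ENNReal.Tendsto.const_mul hr (Or.inr ENNReal.ofReal_ne_top)))
          (Or.inr ENNReal.ofReal_ne_top)) (ENNReal.Tendsto.const_mul hs (Or.inr ?_))
        exact ENNReal.mul_ne_top hk ENNReal.ofReal_ne_top
      simpa using ge_of_tendsto' hlim h4
    by_cases hWt : W.l2Sq c g h ε = ⊤
    · simp [hWt]
    have hc1 : Tendsto (fun η : ℝ ↦ ENNReal.ofReal (1 + η)) (𝓝[>] 0) (𝓝 1) := by
      have : Tendsto (fun η : ℝ ↦ ENNReal.ofReal (1 + η)) (𝓝 0) (𝓝 (ENNReal.ofReal (1 + 0))) :=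
        (ENNReal.continuous_ofReal.comp (continuous_const.add continuous_id)).tendsto 0
      simp only [add_zero, ENNReal.ofReal_one] at this
      exact this.mono_left nhdsWithin_le_nhds
    have hlim : Tendsto (fun η : ℝ ↦
        ENNReal.ofReal (1 + η) * (ENNReal.ofReal (1 + η) * W.l2Sq c g h ε)) (𝓝[>] 0)
        (𝓝 (1 * (1 * W.l2Sq c g h ε))) :=
      ENNReal.Tendsto.mul hc1 (Or.inl one_ne_zero)
        (ENNReal.Tendsto.mul_const hc1 (Or.inl one_ne_zero)) (Or.inr ENNReal.one_ne_top)
    rw [one_mul, one_mul] at hlim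
    refine ge_of_tendsto hlim ?_
    filter_upwards [self_mem_nhdsWithin] with η hη using h3 η hη

end Closure

/-! ### The lower bounds for the Dirac operator on the thin manifold -/

section Rayleigh

variable {X : Type*} [TopologicalSpace X] [T2Space X] [CompactSpace X] [Nonempty X]
  [ChartedSpace ℂ X] [IsManifold 𝓘(ℂ) ω X]
  {L : X → Type*} [TopologicalSpace (TotalSpace ℂ L)]
  [∀ x, NormedAddCommGroup (L x)] [∀ x, InnerProductSpace ℂ (L x)]
  [FiberBundle ℂ L] [VectorBundle ℂ ℂ L] [VectorBundle ℝ ℂ L]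
  [ContMDiffVectorBundle ∞ ℂ L 𝓘(ℝ, ℂ)] [MeasurableSpace X] [BorelSpace X] {c : ℝ} {g : Metric X}
  {nabla : CovariantDerivative 𝓘(ℝ, ℂ) ℂ L} {h : X → ℝ} {ε : ℝ}

/-- A lower bound for the Rayleigh quotients of smooth spinors is one for `lamDirac`. -/
lemma le_lamDirac (hg : IsHermitianMetric g) (hL : IsSmoothHermitian L) (hc : 0 < c)
    (hh : Continuous h) {T : Spinor L → Prop} (hT : ∀ V, T V → V.IsSmooth ε) {k : ℝ≥0∞}
    (hk : k ≠ ⊤)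
    (hbound : ∀ V W, T V → IsDirac c g nabla h ε V W → k * V.l2Sq c g h ε ≤ W.l2Sq c g h ε) :
    k ≤ lamDirac c g nabla h ε T := by
  refine le_iInf fun V ↦ le_iInf fun W ↦ le_iInf fun hVW ↦ le_iInf fun hV0 ↦ ?_
  obtain ⟨hVt, hle⟩ := hVW.energy_bound hg hL hc hh hT hk hbound
  exact (ENNReal.le_div_iff_mul_le (Or.inl hV0) (Or.inl hVt)).2 hle

lemma one_le_of_pinching {K : ℝ} (hK : 0 < K) (hhK : ∀ x, 1 / K ≤ h x ∧ h x ≤ K) : 1 ≤ K := by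
  obtain ⟨x⟩ := ‹Nonempty X›
  have h1 := (div_le_iff₀ hK).1 ((hhK x).1.trans (hhK x).2)
  nlinarith

lemma two_div_le {K : ℝ} (hK1 : 1 ≤ K) (hε : 0 < ε) :
    2 / (K * ε ^ 2) ≤ 2 / ε ^ 2 := by
  have : 0 < ε ^ 2 := by positivity
  gcongr
  nlinarith

/-- The lower bound for `𝒟_-` on `L^{1,2}_-`: the slice operator controls `u`, and `v` vanishes on
the boundary. -/
lemma mul_min_le_lamDirac_minus (hg : IsHermitianMetric g) (hL : IsSmoothHermitian L) (hc : 0 < c)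
    (hh : Continuous h) {K : ℝ} (hK : 0 < K) (hhK : ∀ x, 1 / K ≤ h x ∧ h x ≤ K) (hε : 0 < ε) :
    ENNReal.ofReal (1 / K) * min (lamDelMinus c g nabla) (ENNReal.ofReal (2 / (K * ε ^ 2)))
      ≤ lamDirac c g nabla h ε (TestMinus ε) := by
  have h0 : ∀ x, 0 < h x := fun x ↦ (by positivity : 0 < 1 / K).trans_le (hhK x).1
  refine le_lamDirac hg hL hc hh (fun V hV ↦ hV.1)
    (ENNReal.mul_ne_top ENNReal.ofReal_ne_top
      (ne_top_of_le_ne_top ENNReal.ofReal_ne_top (min_le_right _ _))) ?_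
  rintro V W ⟨hV, a, b, ha, hb, hab⟩ hVW
  refine hVW.energy_bound hg hL hc hh hK hhK hε hV ((min_le_right _ _).trans
    (ENNReal.ofReal_le_ofReal (two_div_le (one_le_of_pinching hK hhK) hε)))
    (Or.inl ⟨⟨hab 0 ⟨le_rfl, hε.le⟩ fun h' ↦ h'.1.not_gt ha,
      hab ε ⟨hε.le, le_rfl⟩ fun h' ↦ h'.2.not_gt hb⟩, fun t ht ↦ ?_⟩)
  refine (mul_le_mul_left (min_le_left _ _) _).trans
    (lamDelMinus_mul_le (hV.smoothSection_u ht) ?_)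
  exact (hVW.contForm_dbar hε hh h0 hV).comp (φ := fun x ↦ (t, x)) (by fun_prop)
    fun x _ ↦ ⟨ht, mem_univ x⟩

/-- The lower bound for `𝒟_+` on `L^{1,2}_+`: the slice operator controls `v`, and `u` vanishes on
the boundary. -/
lemma mul_min_le_lamDirac_plus (hg : IsHermitianMetric g) (hL : IsSmoothHermitian L) (hc : 0 < c)
    (hh : Continuous h) {K : ℝ} (hK : 0 < K) (hhK : ∀ x, 1 / K ≤ h x ∧ h x ≤ K) (hε : 0 < ε) :
    ENNReal.ofReal (1 / K) * min (lamDelPlus c g nabla) (ENNReal.ofReal (2 / (K * ε ^ 2)))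
      ≤ lamDirac c g nabla h ε (TestPlus ε) := by
  refine le_lamDirac hg hL hc hh (fun V hV ↦ hV.1)
    (ENNReal.mul_ne_top ENNReal.ofReal_ne_top
      (ne_top_of_le_ne_top ENNReal.ofReal_ne_top (min_le_right _ _))) ?_
  rintro V W ⟨hV, a, b, ha, hb, hab⟩ hVW
  refine hVW.energy_bound hg hL hc hh hK hhK hε hV ((min_le_right _ _).trans
    (ENNReal.ofReal_le_ofReal (two_div_le (one_le_of_pinching hK hhK) hε)))
    (Or.inr ⟨⟨hab 0 ⟨le_rfl, hε.le⟩ fun h' ↦ h'.1.not_gt ha,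
      hab ε ⟨hε.le, le_rfl⟩ fun h' ↦ h'.2.not_gt hb⟩, fun t ht ↦ ?_⟩)
  exact (mul_le_mul_left (min_le_left _ _) _).trans
    (lamDelPlus_mul_le (hV.smoothForm01_v ht) (hVW.2 t ht).1)

end Rayleigh

/-- Transfer of an inequality from `ℝ≥0∞` to `EReal`, with a smaller, possibly negative, real entry
in the minimum. -/
lemma ereal_mul_min_le {a p q : ℝ} (ha : 0 ≤ a) (hq : 0 ≤ q) {s t : ℝ≥0∞}
    (hpq : p ≤ q) (hst : ENNReal.ofReal a * min s (ENNReal.ofReal q) ≤ t) :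
    (a : EReal) * min (s : EReal) (p : EReal) ≤ t := by
  have h1 : min (s : EReal) (p : EReal) ≤ ((min s (ENNReal.ofReal q) : ℝ≥0∞) : EReal) := by
    have hp : (p : EReal) ≤ ((ENNReal.ofReal q : ℝ≥0∞) : EReal) := by
      rw [EReal.coe_ennreal_ofReal, max_eq_left hq]
      exact EReal.coe_le_coe hpq
    rcases le_total s (ENNReal.ofReal q) with h | h
    · rw [min_eq_left h]
      exact min_le_left _ _
    · rw [min_eq_right h]
      exact (min_le_right _ _).trans hp
  have h2 := EReal.coe_ennreal_le_coe_ennreal_iff.2 hst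
  rw [EReal.coe_ennreal_mul, EReal.coe_ennreal_ofReal, max_eq_left ha] at h2
  exact (mul_le_mul_of_nonneg_left h1 (EReal.coe_nonneg.2 ha)).trans h2

end ThinDirac

theorem theorem3
    -- a compact Riemann surface with a Hermitian metric
    {X : Type*} [TopologicalSpace X] [T2Space X] [CompactSpace X] [Nonempty X]
    [ChartedSpace ℂ X] [IsManifold 𝓘(ℂ) ω X] [MeasurableSpace X] [BorelSpace X]
    (g : ThinDirac.Metric X) (hg : ThinDirac.IsHermitianMetric g)
    -- a smooth Hermitian line bundle with a smooth connection
    {L : X → Type*} [TopologicalSpace (TotalSpace ℂ L)]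
    [∀ x, NormedAddCommGroup (L x)] [∀ x, InnerProductSpace ℂ (L x)]
    [FiberBundle ℂ L] [VectorBundle ℂ ℂ L] [VectorBundle ℝ ℂ L]
    [ContMDiffVectorBundle ∞ ℂ L 𝓘(ℝ, ℂ)]
    (hL : ThinDirac.IsSmoothHermitian L)
    (nabla : CovariantDerivative 𝓘(ℝ, ℂ) ℂ L) [CovariantDerivative.ContMDiffCovariantDerivative nabla ∞]
    (hnabla : ThinDirac.IsComplexLinear nabla)
    -- the normalisation of the metric of `Λ^{0,1}`
    (c : ℝ) (hc : 0 < c) (hc4 : c ≤ 4)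
    -- the warping function and the thickness
    (h : X → ℝ) (hh : ContMDiff 𝓘(ℝ, ℂ) 𝓘(ℝ, ℝ) ∞ h)
    (K : ℝ) (hK : 0 < K) (hhK : ∀ x, 1 / K ≤ h x ∧ h x ≤ K)
    (ε : ℝ) (hε : 0 < ε) :
    ((1 / K : ℝ) : EReal) *
        min (ThinDirac.lamDelMinus c g nabla : EReal)
          ((2 / (K * ε ^ 2) - K * ThinDirac.normC1 g (fun x ↦ (Real.sqrt (h x))⁻¹) ^ 2 : ℝ) : EReal)
      ≤ (ThinDirac.lamDirac c g nabla h ε (ThinDirac.TestMinus ε) : EReal) ∧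
    ((1 / K : ℝ) : EReal) *
        min (ThinDirac.lamDelPlus c g nabla : EReal)
          ((2 / (K * ε ^ 2) - K * ThinDirac.normC1 g (fun x ↦ (Real.sqrt (h x))⁻¹) ^ 2 : ℝ) : EReal)
      ≤ (ThinDirac.lamDirac c g nabla h ε (ThinDirac.TestPlus ε) : EReal) := by
  have h1 : 0 ≤ 1 / K := by positivity
  have h2 : 0 ≤ 2 / (K * ε ^ 2) := by positivity
  have h3 : 2 / (K * ε ^ 2) - K * ThinDirac.normC1 g (fun x ↦ (Real.sqrt (h x))⁻¹) ^ 2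
      ≤ 2 / (K * ε ^ 2) := sub_le_self _ (by positivity)
  exact ⟨ThinDirac.ereal_mul_min_le h1 h2 h3
      (ThinDirac.mul_min_le_lamDirac_minus hg hL hc hh.continuous hK hhK hε),
    ThinDirac.ereal_mul_min_le h1 h2 h3
      (ThinDirac.mul_min_le_lamDirac_plus hg hL hc hh.continuous hK hhK hε)⟩
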